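/- Let $T>0$ and fix $a\in(0,T)$. For complex-valued $p\in AC[0,T]$ (absolutely continuous) and $q\in L^1(0,T)$ consider the differential pencil $$y''(x)+\bigl[\lambda^2-2\lambda p(x)-q(x)\bigr]y(x)=0,\qquad x\in(0,T),\tag{1}$$ with spectral parameter $\lambda\in\mathbb C$ (solutions are understood with $y,y'\in AC[0,T]$ and (1) holding almost everywhere). For $(c,d)\in\{(0,a),(0,T),(a,T)\}$ let $L_{c,d}(p,q)$ be the boundary value problem for (1) with the conditions $y(c)=y(d)=0$. A number $\lambda$ is an eigenvalue of $L_{c,d}(p,q)$ if (1) has a nontrivial solution satisfying these conditions. Let $X_1(x,\lambda),X_2(x,\lambda)$ be the solutions of (1) with $X_1(0,\lambda)=X_2'(0,\lambda)=1$ and $X_1'(0,\lambda)=X_2(0,\lambda)=0$. The eigenvalues are exactly the zeros of the entire function $\Delta_{c,d}(\lambda)=X_1(c,\lambda)X_2(d,\lambda)-X_2(c,\lambda)X_1(d,\lambda)$; the spectrum $\Lambda_{c,d}(p,q)$ is the collection of these zeros counted with their multiplicities as zeros of $\Delta_{c,d}$. Let $(p,q)$ and $(\tilde p,\tilde q)$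 be two such pairs of coefficients with $\int_0^T p(x)\,dx=\int_0^T\tilde p(x)\,dx$, and assume that $L_{0,a}(p,q)$ and $L_{0,T}(p,q)$ have no common eigenvalue. If $$\Lambda_{0,a}(p,q)=\Lambda_{0,a}(\tilde p,\tilde q),\qquad \Lambda_{0,T}(p,q)=\Lambda_{0,T}(\tilde p,\tilde q),\qquad \Lambda_{a,T}(p,q)=\Lambda_{a,T}(\tilde p,\tilde q)$$ (counting multiplicities), then $p(x)=\tilde p(x)$ for all $x\in[0,T]$ and $q(x)=\tilde q(x)$ for almost every $x\in(0,T)$. -/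

import Mathlib

open MeasureTheory Set

noncomputable section

/-- `y`, with derivative `dy`, is a (Caratheodory) solution on `[0, T]` of the pencil equation
`y'' + (z ^ 2 - 2 z p(x) - q(x)) y = 0` with spectral parameter `z`: `y` is differentiable with
derivative `dy`, `dy` is absolutely continuous, and the equation holds almost everywhere. -/
structure IsPencilSolution (T : ℝ) (p q : ℝ → ℂ) (z : ℂ) (y dy : ℝ → ℂ) : Prop where
  hasDeriv : ∀ x ∈ Icc 0 T, HasDerivWithinAt y (dy x) (Icc 0 T) x
  absCont : AbsolutelyContinuousOnInterval dy 0 T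
  equation : ∀ᵐ x ∂(volume.restrict (Ioo 0 T)),
    ∃ ddy : ℂ, HasDerivAt dy ddy x ∧ ddy + (z ^ 2 - 2 * z * p x - q x) * y x = 0

/-- The solution with `y(0) = α`, `y'(0) = β`. Such a solution exists and is unique on `[0, T]`
when `p` is absolutely continuous and `q` is integrable; only its values there matter. -/
def pencilCauchy (T : ℝ) (p q : ℝ → ℂ) (α β : ℂ) (z : ℂ) : ℝ → ℂ :=
  Classical.epsilon fun y : ℝ → ℂ =>
    ∃ dy : ℝ → ℂ, IsPencilSolution T p q z y dy ∧ y 0 = α ∧ dy 0 = β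

/-- `X₁(x, z)`: the solution with `X₁(0) = 1`, `X₁'(0) = 0`. -/
def pencilX₁ (T : ℝ) (p q : ℝ → ℂ) (x : ℝ) (z : ℂ) : ℂ := pencilCauchy T p q 1 0 z x

/-- `X₂(x, z)`: the solution with `X₂(0) = 0`, `X₂'(0) = 1`. -/
def pencilX₂ (T : ℝ) (p q : ℝ → ℂ) (x : ℝ) (z : ℂ) : ℂ := pencilCauchy T p q 0 1 z x

/-- The characteristic function of the problem with conditions `y(c) = y(d) = 0`: the determinant
of the two boundary forms evaluated on the fundamental system `X₁, X₂`. -/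
def dirichletCharFun (T : ℝ) (p q : ℝ → ℂ) (c d : ℝ) (z : ℂ) : ℂ :=
  pencilX₁ T p q c z * pencilX₂ T p q d z - pencilX₂ T p q c z * pencilX₁ T p q d z

/-- The set of eigenvalues of the problem with conditions `y(c) = y(d) = 0`. -/
def dirichletEigenvalues (T : ℝ) (p q : ℝ → ℂ) (c d : ℝ) : Set ℂ :=
  {z | ∃ y dy : ℝ → ℂ, IsPencilSolution T p q z y dy ∧ (∃ x ∈ Icc 0 T, y x ≠ 0) ∧
    y c = 0 ∧ y d = 0}

/-- The spectrum, counted with multiplicity, of the problem with conditions `y(c) = y(d) = 0`,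
as the function that sends `z` to its multiplicity, that is, to its order as a zero of the
(entire) characteristic function; this is `0` when `z` is not an eigenvalue. -/
def dirichletSpectrum (T : ℝ) (p q : ℝ → ℂ) (c d : ℝ) (z : ℂ) : ℕ∞ :=
  analyticOrderAt (dirichletCharFun T p q c d) z

end

/-!
For each pair of coefficients, normalise solutions by their slope at one endpoint: `U` vanishes at
`0` and `W` at `T`. Their values `U(a, ·)`, `U(T, ·)`, `W(a, ·)` are, up to sign, the characteristic
functions of the three problems, and an entire function with the asymptotics of a sine is determined
up to a factor `±1` by its zeros. Evaluating the Wronskian of `U` and `W` at `a` and at `T` and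
comparing the two pencils gives `W (ε Ũ' - U') = U (δ W̃' - W')` at `a`, with `ε, δ = ±1`. Since
`U(a, ·)` and `W(a, ·)` have no common zero, the Weyl functions `U' / U` and `W' / W` at `a` differ
from those of the other pencil by one entire function `F`. On either side of `a`, growth estimates
and Liouville's theorem then force the solutions `φ` vanishing at `a` to agree up to a factor `±1`,
and the asymptotics of `φ` give `p`, and the differential equation `q`.
-/

section AbsolutelyContinuous

variable {E : Type*} [NormedAddCommGroup E] [NormedSpace ℝ E]

theorem absolutelyContinuousOnInterval_of_dist_le_mul {X Y : Type*} [PseudoMetricSpace X]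
    [PseudoMetricSpace Y] {f : ℝ → X} {g : ℝ → Y} {a b K : ℝ}
    (hf : AbsolutelyContinuousOnInterval f a b)
    (hfg : ∀ x ∈ uIcc a b, ∀ y ∈ uIcc a b, dist (g x) (g y) ≤ K * dist (f x) (f y)) :
    AbsolutelyContinuousOnInterval g a b := by
  rw [AbsolutelyContinuousOnInterval] at *
  refine squeeze_zero' (.of_forall fun _ => Finset.sum_nonneg fun _ _ => dist_nonneg) ?_
    (by simpa using hf.const_mul K)
  filter_upwards [Filter.mem_inf_of_right (Filter.mem_principal_self _)] with I hI
  rw [Finset.mul_sum]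
  exact Finset.sum_le_sum fun i hi => hfg _ (hI.1 i hi).1 _ (hI.1 i hi).2

theorem absolutelyContinuousOnInterval_of_hasDerivWithinAt {a b : ℝ} {f f' : ℝ → E}
    (hf : ∀ x ∈ uIcc a b, HasDerivWithinAt f (f' x) (uIcc a b) x)
    (hf' : ContinuousOn f' (uIcc a b)) : AbsolutelyContinuousOnInterval f a b := by
  obtain ⟨C, hC⟩ := isCompact_uIcc.exists_bound_of_continuousOn hf'
  refine LipschitzOnWith.absolutelyContinuousOnInterval (K := C.toNNReal) ?_
  refine (convex_uIcc a b).lipschitzOnWith_of_nnnorm_hasDerivWithin_le hf fun x hx => ?_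
  rw [← NNReal.coe_le_coe, coe_nnnorm]
  exact (hC x hx).trans (Real.le_coe_toNNReal C)

theorem absolutelyContinuousOnInterval_integral {f : ℝ → E} {a b c : ℝ}
    (hf : IntervalIntegrable f volume a b) (hc : c ∈ uIcc a b) :
    AbsolutelyContinuousOnInterval (fun x => ∫ t in c..x, f t) a b := by
  refine absolutelyContinuousOnInterval_of_dist_le_mul (K := 1)
    (hf.norm.absolutelyContinuousOnInterval_intervalIntegral hc) fun x hx y hy => ?_
  have hcx := hf.mono_set (uIcc_subset_uIcc hc hx)
  have hcy := hf.mono_set (uIcc_subset_uIcc hc hy)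
  rw [dist_eq_norm, dist_eq_norm, one_mul, intervalIntegral.integral_interval_sub_left hcx hcy,
    intervalIntegral.integral_interval_sub_left hcx.norm hcy.norm]
  exact intervalIntegral.norm_integral_le_abs_integral_norm

theorem ae_mem_uIcc_imp_uIcc_mem_nhds (a b : ℝ) :
    ∀ᵐ x : ℝ, x ∈ uIcc a b → uIcc a b ∈ nhds x := by
  filter_upwards [compl_mem_ae_iff.2 (measure_singleton (min a b)),
    compl_mem_ae_iff.2 (measure_singleton (max a b))] with x ha hb hx
  exact Icc_mem_nhds (lt_of_le_of_ne hx.1 (Ne.symm ha)) (lt_of_le_of_ne hx.2 hb)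

theorem integral_eq_sub_of_ae_hasDerivAt [CompleteSpace E] {f g : ℝ → E} {a b s x : ℝ}
    (hf : AbsolutelyContinuousOnInterval f a b) (hg : IntervalIntegrable g volume a b)
    (hfg : ∀ᵐ x, x ∈ uIcc a b → HasDerivAt f (g x) x) (hs : s ∈ uIcc a b) (hx : x ∈ uIcc a b) :
    ∫ t in s..x, g t = f x - f s := by
  obtain ⟨C, hC⟩ := (hf.fun_sub
    (absolutelyContinuousOnInterval_integral hg hs)).const_of_ae_hasDerivAt_zero (by
      filter_upwards [hfg, hg.ae_hasDerivAt_integral] with y h₁ h₂ hy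
      simpa using! (h₁ hy).sub (h₂ hy s hs))
  have hCs : f s = C := by simpa using hC s hs
  rw [hCs, ← hC x hx, sub_sub_cancel]

theorem hasDerivWithinAt_integral_of_continuousOn [CompleteSpace E] {f : ℝ → E} {a b s x : ℝ}
    (hf : ContinuousOn f (Icc a b)) (hs : s ∈ Icc a b) (hx : x ∈ Icc a b) :
    HasDerivWithinAt (fun u => ∫ t in s..u, f t) (f x) (Icc a b) x :=
  have : Fact (x ∈ Icc a b) := ⟨hx⟩
  intervalIntegral.integral_hasDerivWithinAt_right
    (hf.mono (ordConnected_Icc.uIcc_subset hs hx)).intervalIntegrable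
    (hf.stronglyMeasurableAtFilter_nhdsWithin measurableSet_Icc x) (hf x hx)

theorem ae_hasDerivAt_of_absolutelyContinuous {f : ℝ → ℂ} {a b : ℝ}
    (hf : AbsolutelyContinuousOnInterval f a b) :
    ∀ᵐ x, x ∈ uIcc a b → HasDerivAt f (deriv f x) x :=
  hf.boundedVariationOn.ae_differentiableAt_of_mem_uIcc.mono fun _ h hx => (h hx).hasDerivAt

theorem intervalIntegrable_deriv_of_absolutelyContinuous {f : ℝ → ℂ} {a b : ℝ}
    (hf : AbsolutelyContinuousOnInterval f a b) : IntervalIntegrable (deriv f) volume a b := by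
  have hre : AbsolutelyContinuousOnInterval (fun x => (f x).re) a b :=
    absolutelyContinuousOnInterval_of_dist_le_mul (K := 1) hf fun x _ y _ => by
      simpa [dist_eq_norm] using Complex.abs_re_le_norm (f x - f y)
  have him : AbsolutelyContinuousOnInterval (fun x => (f x).im) a b :=
    absolutelyContinuousOnInterval_of_dist_le_mul (K := 1) hf fun x _ y _ => by
      simpa [dist_eq_norm] using Complex.abs_im_le_norm (f x - f y)
  have hint := hre.intervalIntegrable_deriv.norm.add him.intervalIntegrable_deriv.norm
  refine hint.mono_fun (aestronglyMeasurable_deriv f _) ?_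
  rw [Filter.EventuallyLE, ae_restrict_iff' measurableSet_uIoc]
  filter_upwards [ae_hasDerivAt_of_absolutelyContinuous hf] with x hfx hx
  have hfx := hfx (uIoc_subset_uIcc hx)
  have hre' : deriv (fun x => (f x).re) x = (deriv f x).re :=
    (Complex.reCLM.hasFDerivAt.comp_hasDerivAt x hfx).deriv
  have him' : deriv (fun x => (f x).im) x = (deriv f x).im :=
    (Complex.imCLM.hasFDerivAt.comp_hasDerivAt x hfx).deriv
  rw [hre', him', Real.norm_eq_abs, Real.norm_eq_abs, Real.norm_eq_abs]
  exact (Complex.norm_le_abs_re_add_abs_im _).trans (le_abs_self _)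

theorem integral_mul_primitive_pow {f : ℝ → ℝ} {a b : ℝ} (hf : IntervalIntegrable f volume a b)
    (n : ℕ) :
    ∫ t in a..b, f t * (∫ s in a..t, f s) ^ n = (∫ s in a..b, f s) ^ (n + 1) / (n + 1) := by
  set F : ℝ → ℝ := fun t => ∫ s in a..t, f s
  have hF : AbsolutelyContinuousOnInterval F a b :=
    absolutelyContinuousOnInterval_integral hf left_mem_uIcc
  have hpow (k : ℕ) : AbsolutelyContinuousOnInterval (fun t => F t ^ (k + 1)) a b := by
    induction k with
    | zero => simpa using hF
    | succ k ih => simpa only [pow_succ _ (k + 1)] using ih.fun_mul hF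
  have hderiv : ∀ᵐ x, x ∈ uIcc a b →
      HasDerivAt (fun t => F t ^ (n + 1)) ((n + 1) * (f x * F x ^ n)) x := by
    filter_upwards [hf.ae_hasDerivAt_integral] with x h hx
    convert! (h hx a left_mem_uIcc).pow (n + 1) using 1
    simp only [F, Nat.cast_add, Nat.cast_one, add_tsub_cancel_right]
    ring
  have hint : IntervalIntegrable (fun x => (n + 1) * (f x * F x ^ n)) volume a b :=
    (hf.mul_continuousOn (hF.continuousOn.pow n)).const_mul _
  have hftc := integral_eq_sub_of_ae_hasDerivAt (hpow n) hint hderiv left_mem_uIcc right_mem_uIcc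
  rw [intervalIntegral.integral_const_mul] at hftc
  rw [eq_div_iff (by positivity), mul_comm, hftc]
  simp [F]

theorem eq_zero_of_exp_mul_integral_eq_one {f : ℝ → ℂ} {a b s : ℝ} {c : ℂ} (hc : c ≠ 0)
    (hab : a < b) (hf : ContinuousOn f (Icc a b)) (hs : s ∈ Icc a b)
    (hexp : ∀ x ∈ Icc a b, Complex.exp (c * ∫ t in s..x, f t) = 1) : ∀ x ∈ Icc a b, f x = 0 := by
  intro x hx
  have hderiv := ((hasDerivWithinAt_integral_of_continuousOn hf hs hx).const_mul c).cexp
  have hzero := (uniqueDiffOn_Icc hab x hx).eq_deriv _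
    (hderiv.congr_of_mem (fun u hu => (hexp u hu).symm) hx) (hasDerivWithinAt_const x _ (1 : ℂ))
  simpa [hc] using hzero

end AbsolutelyContinuous

theorem isUnit_one_sub_of_norm_pow_lt_one {R : Type*} [NormedRing R] [HasSummableGeomSeries R]
    {x : R} {n : ℕ} (h : ‖x ^ n‖ < 1) : IsUnit (1 - x) := by
  have hcomm : Commute (1 - x) (∑ i ∈ Finset.range n, x ^ i) :=
    Commute.sum_right _ _ _ fun i _ => (Commute.one_left _).sub_left (Commute.self_pow x i)
  have hunit : IsUnit ((1 - x) * ∑ i ∈ Finset.range n, x ^ i) := by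
    rw [mul_neg_geom_sum]
    exact isUnit_one_sub_of_norm_lt_one h
  exact (hcomm.isUnit_mul_iff.1 hunit).1

noncomputable section Volterra

variable {𝕜 : Type*} [RCLike 𝕜] {a b : ℝ} (hab : a ≤ b) {r : ℝ → 𝕜}
  (hr : IntervalIntegrable r volume a b)

include hr in
theorem intervalIntegrable_mul_projIcc (f : C(Icc a b, 𝕜)) (x : Icc a b) :
    IntervalIntegrable (fun t => r t * f (projIcc a b hab t)) volume a x :=
  (hr.mul_continuousOn (f.continuous.comp continuous_projIcc).continuousOn).mono_set
    (uIcc_subset_uIcc left_mem_uIcc (Icc_subset_uIcc x.2))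

include hr in
theorem continuous_integral_mul_projIcc (f : C(Icc a b, 𝕜)) :
    Continuous fun x : Icc a b => ∫ t in a..x, r t * f (projIcc a b hab t) := by
  have hac := absolutelyContinuousOnInterval_integral
    (intervalIntegrable_mul_projIcc hab hr f ⟨b, right_mem_Icc.2 hab⟩) left_mem_uIcc
  have hcont := hac.continuousOn
  rw [uIcc_of_le hab] at hcont
  exact continuousOn_iff_continuous_domRestrict.1 hcont

/-- The Volterra operator `f ↦ ∫ₐˣ r f` on continuous functions, as a linear map. Functions on
`[a, b]` are extended to the line by `projIcc` to be integrated. -/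
def volterraLinear : C(Icc a b, 𝕜) →ₗ[𝕜] C(Icc a b, 𝕜) where
  toFun f := ⟨fun x => ∫ t in a..x, r t * f (projIcc a b hab t),
    continuous_integral_mul_projIcc hab hr f⟩
  map_add' f g := by
    ext x
    simp only [ContinuousMap.coe_mk, ContinuousMap.add_apply, mul_add]
    exact intervalIntegral.integral_add (intervalIntegrable_mul_projIcc hab hr f x)
      (intervalIntegrable_mul_projIcc hab hr g x)
  map_smul' c f := by
    ext x
    simp only [ContinuousMap.coe_mk, ContinuousMap.smul_apply, smul_eq_mul, RingHom.id_apply,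
      mul_left_comm _ c]
    exact intervalIntegral.integral_const_mul c _

theorem norm_volterraLinear_apply_le {g : ℝ → ℝ} (f : C(Icc a b, 𝕜)) (x : Icc a b)
    (hfg : ∀ t : Icc a b, ‖f t‖ ≤ g t) (hg : ContinuousOn g (Icc a b)) :
    ‖volterraLinear hab hr f x‖ ≤ ∫ t in a..x, ‖r t‖ * g t := by
  have hax : uIcc a x ⊆ Icc a b := ordConnected_Icc.uIcc_subset (left_mem_Icc.2 hab) x.2
  refine intervalIntegral.norm_integral_le_of_norm_le x.2.1 (.of_forall fun t ht => ?_) ?_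
  · have hmem : t ∈ Icc a b := ⟨ht.1.le, ht.2.trans x.2.2⟩
    rw [norm_mul, projIcc_of_mem hab hmem]
    exact mul_le_mul_of_nonneg_left (hfg ⟨t, hmem⟩) (norm_nonneg _)
  · exact (hr.norm.mono_set (hax.trans Icc_subset_uIcc)).mul_continuousOn (hg.mono hax)

include hr in
theorem integral_norm_le_of_mem_Icc {x : ℝ} (hx : x ∈ Icc a b) :
    ∫ t in a..x, ‖r t‖ ≤ ∫ t in a..b, ‖r t‖ :=
  intervalIntegral.integral_mono_interval le_rfl hx.1 hx.2 (.of_forall fun _ => norm_nonneg _)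
    hr.norm

/-- The Volterra operator `f ↦ ∫ₐˣ r f` on continuous functions, as a bounded operator; the
solutions of `y'' = r y` are the fixed points of an affine map built from two such operators. -/
def volterra : C(Icc a b, 𝕜) →L[𝕜] C(Icc a b, 𝕜) :=
  (volterraLinear hab hr).mkContinuous (∫ t in a..b, ‖r t‖) fun f => by
    have hr₀ : 0 ≤ ∫ t in a..b, ‖r t‖ :=
      intervalIntegral.integral_nonneg hab fun _ _ => norm_nonneg _
    rw [ContinuousMap.norm_le _ (mul_nonneg hr₀ (norm_nonneg _))]
    intro x
    refine (norm_volterraLinear_apply_le hab hr (g := fun _ => ‖f‖) f x f.norm_coe_le_norm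
      continuousOn_const).trans ?_
    rw [intervalIntegral.integral_mul_const]
    exact mul_le_mul_of_nonneg_right (integral_norm_le_of_mem_Icc hr x.2) (norm_nonneg _)

theorem volterra_apply (f : C(Icc a b, 𝕜)) (x : Icc a b) :
    volterra hab hr f x = ∫ t in a..x, r t * f (projIcc a b hab t) := rfl

theorem norm_volterra_apply_le_primitive_pow {C : ℝ} {n : ℕ} (f : C(Icc a b, 𝕜)) (x : Icc a b)
    (hf : ∀ t : Icc a b, ‖f t‖ ≤ C * (∫ s in a..t, ‖r s‖) ^ n) :
    ‖volterra hab hr f x‖ ≤ C * (∫ s in a..x, ‖r s‖) ^ (n + 1) / (n + 1) := by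
  have hcont := (absolutelyContinuousOnInterval_integral hr.norm left_mem_uIcc).continuousOn
  have hrx : IntervalIntegrable (fun t => ‖r t‖) volume a x :=
    hr.norm.mono_set (uIcc_subset_uIcc left_mem_uIcc (Icc_subset_uIcc x.2))
  refine (norm_volterraLinear_apply_le hab hr
    (g := fun t => C * (∫ s in a..t, ‖r s‖) ^ n) f x hf
    ((continuousOn_const.mul (hcont.pow n)).mono Icc_subset_uIcc)).trans_eq ?_
  simp only [mul_left_comm _ C]
  rw [intervalIntegral.integral_const_mul, integral_mul_primitive_pow hrx, mul_div_assoc]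

theorem norm_volterra_one_apply_le {C : ℝ} (f : C(Icc a b, 𝕜)) (x : Icc a b)
    (hf : ∀ t ≤ x, ‖f t‖ ≤ C) :
    ‖volterra hab (r := fun _ => 1) intervalIntegrable_const f x‖ ≤ (b - a) * C := by
  have hC : 0 ≤ C := (norm_nonneg _).trans (hf x le_rfl)
  rw [volterra_apply]
  refine (intervalIntegral.norm_integral_le_of_norm_le_const (C := C) fun t ht => ?_).trans ?_
  · rw [uIoc_of_le x.2.1] at ht
    rw [one_mul, projIcc_of_mem hab ⟨ht.1.le, ht.2.trans x.2.2⟩]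
    exact hf _ ht.2
  · rw [abs_of_nonneg (sub_nonneg.2 x.2.1), mul_comm]
    exact mul_le_mul_of_nonneg_right (sub_le_sub_right x.2.2 a) hC

/-- The operator `f ↦ ∫ₐˣ ∫ₐᵗ r f`. A function `y` solves `y'' = r y` exactly when `y` minus its
image under this operator is affine, so that invertibility of the difference settles existence and
uniqueness for the Cauchy problem. -/
def secondVolterra : C(Icc a b, 𝕜) →L[𝕜] C(Icc a b, 𝕜) :=
  volterra hab (r := fun _ => (1 : 𝕜)) intervalIntegrable_const * volterra hab hr

theorem secondVolterra_apply (f : C(Icc a b, 𝕜)) (x : Icc a b) :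
    secondVolterra hab hr f x = ∫ t in a..x, ∫ s in a..t, r s * f (projIcc a b hab s) := by
  refine (volterra_apply hab intervalIntegrable_const _ x).trans
    (intervalIntegral.integral_congr fun t ht => ?_)
  have ht : t ∈ Icc a b := ordConnected_Icc.uIcc_subset (left_mem_Icc.2 hab) x.2 ht
  simp only [one_mul, projIcc_of_mem hab ht]
  rfl

theorem norm_secondVolterra_pow_apply_le (n : ℕ) (f : C(Icc a b, 𝕜)) (x : Icc a b) :
    ‖(secondVolterra hab hr ^ n) f x‖ ≤
      ‖f‖ * (b - a) ^ n / n.factorial * (∫ t in a..x, ‖r t‖) ^ n := by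
  induction n generalizing x with
  | zero => simpa using f.norm_coe_le_norm x
  | succ n ih =>
    rw [pow_succ', mul_apply_eq_comp, secondVolterra, mul_apply_eq_comp]
    refine (norm_volterra_one_apply_le hab _ x
      (C := ‖f‖ * (b - a) ^ n / n.factorial * (∫ t in a..x, ‖r t‖) ^ (n + 1) / (n + 1))
      fun t ht => (norm_volterra_apply_le_primitive_pow hab hr _ t ih).trans ?_).trans_eq ?_
    · have hrx : IntervalIntegrable r volume a x :=
        hr.mono_set (uIcc_subset_uIcc left_mem_uIcc (Icc_subset_uIcc x.2))
      have hmono := integral_norm_le_of_mem_Icc hrx (x := t) ⟨t.2.1, ht⟩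
      have hnonneg : 0 ≤ ∫ s in a..t, ‖r s‖ :=
        intervalIntegral.integral_nonneg t.2.1 fun _ _ => norm_nonneg _
      gcongr
    · rw [Nat.factorial_succ]
      push_cast
      field_simp
      ring

theorem isUnit_one_sub_secondVolterra : IsUnit (1 - secondVolterra hab hr) := by
  set K := secondVolterra hab hr
  set M := ∫ t in a..b, ‖r t‖
  have hM : 0 ≤ M := intervalIntegral.integral_nonneg hab fun _ _ => norm_nonneg _
  have hpow (n : ℕ) : ‖K ^ n‖ ≤ ((b - a) * M) ^ n / n.factorial := by
    refine ContinuousLinearMap.opNorm_le_bound _ (by positivity) fun f => ?_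
    rw [ContinuousMap.norm_le _ (by positivity)]
    intro x
    have hx : ∫ t in a..x, ‖r t‖ ≤ M := integral_norm_le_of_mem_Icc hr x.2
    have hx₀ : 0 ≤ ∫ t in a..x, ‖r t‖ :=
      intervalIntegral.integral_nonneg x.2.1 fun _ _ => norm_nonneg _
    calc ‖(K ^ n) f x‖ ≤ ‖f‖ * (b - a) ^ n / n.factorial * (∫ t in a..x, ‖r t‖) ^ n :=
          norm_secondVolterra_pow_apply_le hab hr n f x
      _ ≤ ‖f‖ * (b - a) ^ n / n.factorial * M ^ n := by gcongr
      _ = ((b - a) * M) ^ n / n.factorial * ‖f‖ := by rw [mul_pow]; ring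
  obtain ⟨n, hn⟩ := ((FloorSemiring.tendsto_pow_div_factorial_atTop ((b - a) * M)).eventually
    (gt_mem_nhds one_pos)).exists
  exact isUnit_one_sub_of_norm_pow_lt_one (x := K) ((hpow n).trans_lt hn)

end Volterra

/-- The potential `Q` for which the pencil equation reads `y'' = Q y`. -/
noncomputable def pencilPotential (p q : ℝ → ℂ) (z : ℂ) (x : ℝ) : ℂ := q x + 2 * z * p x - z ^ 2

theorem intervalIntegrable_pencilPotential {p q : ℝ → ℂ} {a b : ℝ}
    (hp : IntervalIntegrable p volume a b) (hq : IntervalIntegrable q volume a b) (z : ℂ) :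
    IntervalIntegrable (pencilPotential p q z) volume a b :=
  (hq.add (hp.const_mul _)).sub intervalIntegrable_const

theorem volterra_pencilPotential {p q : ℝ → ℂ} {a b : ℝ} (hab : a ≤ b)
    (hp : IntervalIntegrable p volume a b) (hq : IntervalIntegrable q volume a b) (z : ℂ) :
    volterra hab (intervalIntegrable_pencilPotential hp hq z) =
      volterra hab hq + (2 * z) • volterra hab hp -
        z ^ 2 • volterra hab (r := fun _ => (1 : ℂ)) intervalIntegrable_const := by
  ext f x
  have hiq := intervalIntegrable_mul_projIcc hab hq f x
  have hip := (intervalIntegrable_mul_projIcc hab hp f x).const_mul (2 * z)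
  have hi1 := (intervalIntegrable_mul_projIcc hab (r := fun _ => (1 : ℂ))
    intervalIntegrable_const f x).const_mul (z ^ 2)
  simp only [sub_apply, add_apply, smul_apply, ContinuousMap.sub_apply, ContinuousMap.add_apply,
    ContinuousMap.smul_apply, volterra_apply, smul_eq_mul]
  rw [← intervalIntegral.integral_const_mul, ← intervalIntegral.integral_const_mul,
    ← intervalIntegral.integral_add hiq hip, ← intervalIntegral.integral_sub (hiq.add hip) hi1]
  refine intervalIntegral.integral_congr fun t _ => ?_
  simp only [pencilPotential]
  ring

theorem differentiable_quadratic_pencil {E : Type*} [NormedAddCommGroup E] [NormedSpace ℂ E]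
    (A B C : E →L[ℂ] E) : Differentiable ℂ fun z : ℂ => A + (2 * z) • B - z ^ 2 • C := by
  fun_prop

theorem differentiable_volterra_pencilPotential {p q : ℝ → ℂ} {a b : ℝ} (hab : a ≤ b)
    (hp : IntervalIntegrable p volume a b) (hq : IntervalIntegrable q volume a b) :
    Differentiable ℂ fun z => volterra hab (intervalIntegrable_pencilPotential hp hq z) := by
  simp only [volterra_pencilPotential hab hp hq]
  exact differentiable_quadratic_pencil _ _ _

namespace IsPencilSolution

variable {T : ℝ} {p q : ℝ → ℂ} {z : ℂ} {y dy w dw : ℝ → ℂ}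

theorem ae_hasDerivAt (h : IsPencilSolution T p q z y dy) :
    ∀ᵐ x, x ∈ Icc 0 T → HasDerivAt dy (pencilPotential p q z x * y x) x := by
  have heq := h.equation
  rw [ae_restrict_iff' measurableSet_Ioo] at heq
  filter_upwards [heq, ae_mem_uIcc_imp_uIcc_mem_nhds 0 T] with x hx hnhds hmem
  have hmem' := mem_interior_iff_mem_nhds.2 (hnhds (Icc_subset_uIcc hmem))
  rw [uIcc_of_le (hmem.1.trans hmem.2), interior_Icc] at hmem'
  obtain ⟨d, hd, he⟩ := hx hmem'
  convert hd using 1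
  rw [pencilPotential]
  linear_combination -he

theorem continuousOn (h : IsPencilSolution T p q z y dy) : ContinuousOn y (Icc 0 T) :=
  fun x hx => (h.hasDeriv x hx).continuousWithinAt

theorem absolutelyContinuous (hT : 0 ≤ T) (h : IsPencilSolution T p q z y dy) :
    AbsolutelyContinuousOnInterval y 0 T :=
  absolutelyContinuousOnInterval_of_hasDerivWithinAt
    (by simpa only [uIcc_of_le hT] using h.hasDeriv) h.absCont.continuousOn

theorem ae_hasDerivAt_self (h : IsPencilSolution T p q z y dy) :
    ∀ᵐ x, x ∈ Icc 0 T → HasDerivAt y (dy x) x := by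
  filter_upwards [ae_mem_uIcc_imp_uIcc_mem_nhds 0 T] with x hnhds hx
  have hnhds := hnhds (Icc_subset_uIcc hx)
  rw [uIcc_of_le (hx.1.trans hx.2)] at hnhds
  exact (h.hasDeriv x hx).hasDerivAt hnhds

theorem integral_deriv (h : IsPencilSolution T p q z y dy) {s x : ℝ}
    (hs : s ∈ Icc 0 T) (hx : x ∈ Icc 0 T) : ∫ t in s..x, dy t = y x - y s := by
  have hT : 0 ≤ T := hs.1.trans hs.2
  refine integral_eq_sub_of_ae_hasDerivAt (h.absolutelyContinuous hT)
    h.absCont.continuousOn.intervalIntegrable ?_ (Icc_subset_uIcc hs) (Icc_subset_uIcc hx)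
  simpa only [uIcc_of_le hT] using h.ae_hasDerivAt_self

theorem integral_potential_mul (hp : IntervalIntegrable p volume 0 T)
    (hq : IntervalIntegrable q volume 0 T) (h : IsPencilSolution T p q z y dy) {s x : ℝ}
    (hs : s ∈ Icc 0 T) (hx : x ∈ Icc 0 T) :
    ∫ t in s..x, pencilPotential p q z t * y t = dy x - dy s := by
  have hT : 0 ≤ T := hs.1.trans hs.2
  have hcont := h.continuousOn
  have hderiv := h.ae_hasDerivAt
  rw [← uIcc_of_le hT] at hcont hderiv
  exact integral_eq_sub_of_ae_hasDerivAt h.absCont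
    ((intervalIntegrable_pencilPotential hp hq z).mul_continuousOn hcont) hderiv
    (Icc_subset_uIcc hs) (Icc_subset_uIcc hx)

theorem linear_comb (α β : ℂ) (hy : IsPencilSolution T p q z y dy)
    (hw : IsPencilSolution T p q z w dw) :
    IsPencilSolution T p q z (fun x => α * y x + β * w x) (fun x => α * dy x + β * dw x) where
  hasDeriv x hx := ((hy.hasDeriv x hx).const_mul α).add ((hw.hasDeriv x hx).const_mul β)
  absCont := (hy.absCont.const_smul α).fun_add (hw.absCont.const_smul β)
  equation := by
    filter_upwards [hy.equation, hw.equation] with x ⟨d, hd, hyx⟩ ⟨e, he, hwx⟩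
    exact ⟨α * d + β * e, (hd.const_mul α).add (he.const_mul β), by
      linear_combination α * hyx + β * hwx⟩

theorem eq_zero_of_initial (hp : IntervalIntegrable p volume 0 T)
    (hq : IntervalIntegrable q volume 0 T) (h : IsPencilSolution T p q z y dy) (hy : y 0 = 0)
    (hdy : dy 0 = 0) : ∀ x ∈ Icc 0 T, y x = 0 ∧ dy x = 0 := by
  intro x hx
  have hT : 0 ≤ T := hx.1.trans hx.2
  have h₀ : (0 : ℝ) ∈ Icc 0 T := left_mem_Icc.2 hT
  have hQ := intervalIntegrable_pencilPotential hp hq z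
  let f : C(Icc (0 : ℝ) T, ℂ) := ⟨_, continuousOn_iff_continuous_domRestrict.1 h.continuousOn⟩
  have hdy_eq (t : ℝ) (ht : t ∈ Icc 0 T) :
      ∫ s in (0 : ℝ)..t, pencilPotential p q z s * f (projIcc 0 T hT s) = dy t := by
    rw [← sub_zero (dy t), ← hdy, ← h.integral_potential_mul hp hq h₀ ht]
    refine intervalIntegral.integral_congr fun s hs => ?_
    simp only [projIcc_of_mem hT (ordConnected_Icc.uIcc_subset h₀ ht hs)]
    rfl
  let K := secondVolterra hT hQ
  have hfixed : (1 - K) f = 0 := by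
    ext t
    change y t - secondVolterra hT hQ f t = 0
    rw [secondVolterra_apply, intervalIntegral.integral_congr fun s hs =>
      hdy_eq s (ordConnected_Icc.uIcc_subset h₀ t.2 hs), h.integral_deriv h₀ t.2, hy]
    ring
  have hf : f = 0 := by
    have hinv := DFunLike.congr_fun
      (Ring.inverse_mul_cancel (1 - K) (isUnit_one_sub_secondVolterra hT hQ)) f
    rwa [mul_apply_eq_comp, hfixed, map_zero, one_apply_eq_self, eq_comm] at hinv
  exact ⟨DFunLike.congr_fun hf ⟨x, hx⟩, by simp [← hdy_eq x hx, hf]⟩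

theorem eq_of_initial (hp : IntervalIntegrable p volume 0 T)
    (hq : IntervalIntegrable q volume 0 T) (hy : IsPencilSolution T p q z y dy)
    (hw : IsPencilSolution T p q z w dw) (h₀ : y 0 = w 0) (h₁ : dy 0 = dw 0) :
    ∀ x ∈ Icc 0 T, y x = w x ∧ dy x = dw x := by
  intro x hx
  have hzero := (hy.linear_comb 1 (-1) hw).eq_zero_of_initial hp hq (by simp [h₀]) (by simp [h₁])
    x hx
  exact ⟨by linear_combination hzero.1, by linear_combination hzero.2⟩

theorem wronskian_eq (hy : IsPencilSolution T p q z y dy) (hw : IsPencilSolution T p q z w dw)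
    {s x : ℝ} (hs : s ∈ Icc 0 T) (hx : x ∈ Icc 0 T) :
    y x * dw x - dy x * w x = y s * dw s - dy s * w s := by
  have hT : 0 ≤ T := hs.1.trans hs.2
  have hac := ((hy.absolutelyContinuous hT).fun_smul hw.absCont).fun_sub
    (hy.absCont.fun_smul (hw.absolutelyContinuous hT))
  obtain ⟨C, hC⟩ := hac.const_of_ae_hasDerivAt_zero (by
    filter_upwards [hy.ae_hasDerivAt, hw.ae_hasDerivAt, hy.ae_hasDerivAt_self,
      hw.ae_hasDerivAt_self] with t hddy hddw hdy hdw ht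
    rw [uIcc_of_le hT] at ht
    refine (((hdy ht).mul (hddw ht)).sub ((hddy ht).mul (hdw ht))).congr_deriv ?_
    ring)
  exact (hC x (Icc_subset_uIcc hx)).trans (hC s (Icc_subset_uIcc hs)).symm

end IsPencilSolution

theorem isPencilSolution_of_integral_eq {T : ℝ} {p q : ℝ → ℂ} {z α β : ℂ} {y : ℝ → ℂ}
    (hT : 0 ≤ T) (hp : IntervalIntegrable p volume 0 T) (hq : IntervalIntegrable q volume 0 T)
    (hy : ContinuousOn y (Icc 0 T))
    (heq : ∀ x ∈ Icc 0 T,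
      y x = α + β * x + ∫ t in (0 : ℝ)..x, ∫ s in (0 : ℝ)..t, pencilPotential p q z s * y s) :
    IsPencilSolution T p q z y
      (fun x => β + ∫ s in (0 : ℝ)..x, pencilPotential p q z s * y s) := by
  rw [← uIcc_of_le hT] at hy
  have hint := (intervalIntegrable_pencilPotential hp hq z).mul_continuousOn hy
  have hac := absolutelyContinuousOnInterval_integral hint left_mem_uIcc
  refine ⟨fun x hx => ?_, ?_, ?_⟩
  · have hlin : HasDerivWithinAt (fun x : ℝ => α + β * x) β (Icc 0 T) x := by
      simpa using (((hasDerivAt_id x).ofReal_comp.const_mul β).const_add α).hasDerivWithinAt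
    exact (hlin.add (hasDerivWithinAt_integral_of_continuousOn
      (hac.continuousOn.mono Icc_subset_uIcc) (left_mem_Icc.2 hT) hx)).congr_of_mem heq hx
  · exact absolutelyContinuousOnInterval_of_dist_le_mul (K := 1) hac fun x _ y _ => by simp
  · rw [ae_restrict_iff' measurableSet_Ioo]
    filter_upwards [hint.ae_hasDerivAt_integral] with x hderiv hx
    refine ⟨_, (hderiv (Icc_subset_uIcc (Ioo_subset_Icc_self hx)) 0 left_mem_uIcc).const_add β, ?_⟩
    simp only [pencilPotential]
    ring

/-- A family `y x z` of solutions of the pencil equation with parameter `z`, with `x`-derivative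
`dy x z` and with Cauchy data `α, β` at `c` for every `z`, depending analytically on `z`. -/
structure IsPencilFamily (T : ℝ) (p q : ℝ → ℂ) (c : ℝ) (α β : ℂ) (y dy : ℝ → ℂ → ℂ) : Prop where
  solution : ∀ z, IsPencilSolution T p q z (y · z) (dy · z)
  differentiable : ∀ x ∈ Icc 0 T, Differentiable ℂ (y x)
  differentiable_deriv : ∀ x ∈ Icc 0 T, Differentiable ℂ (dy x)
  apply_self : ∀ z, y c z = α
  deriv_self : ∀ z, dy c z = β

theorem exists_isPencilFamily_zero {T : ℝ} {p q : ℝ → ℂ} (hT : 0 ≤ T)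
    (hp : IntervalIntegrable p volume 0 T) (hq : IntervalIntegrable q volume 0 T) (α β : ℂ) :
    ∃ y dy : ℝ → ℂ → ℂ, IsPencilFamily T p q 0 α β y dy := by
  let V (z : ℂ) := volterra hT (intervalIntegrable_pencilPotential hp hq z)
  let K (z : ℂ) := secondVolterra hT (intervalIntegrable_pencilPotential hp hq z)
  let A : C(Icc (0 : ℝ) T, ℂ) := ⟨fun x => α + β * ((x : ℝ) : ℂ), by fun_prop⟩
  let Y (z : ℂ) : C(Icc (0 : ℝ) T, ℂ) := Ring.inverse (1 - K z) A
  have hV : Differentiable ℂ V := differentiable_volterra_pencilPotential hT hp hq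
  have hK : Differentiable ℂ K := (differentiable_const
    (volterra hT (r := fun _ => (1 : ℂ)) intervalIntegrable_const)).clm_comp hV
  have hunit (z : ℂ) : IsUnit (1 - K z) := isUnit_one_sub_secondVolterra hT _
  have hY : Differentiable ℂ Y := fun z =>
    (DifferentiableAt.comp (g := Ring.inverse) z (differentiableAt_inverse (hunit z))
      ((hK z).const_sub 1)).clm_apply (differentiableAt_const A)
  have hYK (z : ℂ) : Y z = A + K z (Y z) := by
    have hinv : (1 - K z) (Y z) = A := by
      rw [← mul_apply_eq_comp, Ring.mul_inverse_cancel _ (hunit z), one_apply_eq_self]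
    rw [← hinv]
    exact (sub_add_cancel _ _).symm
  have hsol (z : ℂ) := isPencilSolution_of_integral_eq (z := z) (α := α) (β := β)
    (y := fun x => Y z (projIcc 0 T hT x)) hT hp hq
    ((Y z).continuous.comp continuous_projIcc).continuousOn fun x hx => by
      rw [← secondVolterra_apply hT (intervalIntegrable_pencilPotential hp hq z) (Y z) ⟨x, hx⟩,
        projIcc_of_mem hT hx]
      exact DFunLike.congr_fun (hYK z) ⟨x, hx⟩
  refine ⟨_, fun x z => _, hsol, fun x _ => ?_, fun x hx => ?_, fun z => ?_, fun z => ?_⟩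
  · exact (ContinuousMap.evalCLM ℂ (projIcc 0 T hT x)).differentiable.comp hY
  · exact ((ContinuousMap.evalCLM ℂ (⟨x, hx⟩ : Icc (0 : ℝ) T)).differentiable.comp
      (hV.clm_apply hY)).const_add β
  · rw [hYK]
    simp [K, A, secondVolterra_apply]
  · simp

theorem exists_isPencilFamily {T c : ℝ} {p q : ℝ → ℂ} (hc : c ∈ Icc 0 T)
    (hp : IntervalIntegrable p volume 0 T) (hq : IntervalIntegrable q volume 0 T) (α β : ℂ) :
    ∃ y dy : ℝ → ℂ → ℂ, IsPencilFamily T p q c α β y dy := by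
  have hT : 0 ≤ T := hc.1.trans hc.2
  obtain ⟨X, dX, hX⟩ := exists_isPencilFamily_zero hT hp hq 1 0
  obtain ⟨S, dS, hS⟩ := exists_isPencilFamily_zero hT hp hq 0 1
  have hW (z : ℂ) : X c z * dS c z - dX c z * S c z = 1 := by
    rw [(hX.solution z).wronskian_eq (hS.solution z) (left_mem_Icc.2 hT) hc, hX.apply_self,
      hX.deriv_self, hS.apply_self, hS.deriv_self]
    norm_num
  have hX₀ := hX.differentiable c hc
  have hX₁ := hX.differentiable_deriv c hc
  have hS₀ := hS.differentiable c hc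
  have hS₁ := hS.differentiable_deriv c hc
  exact ⟨_, _, {
    solution z := (hX.solution z).linear_comb (α * dS c z - β * S c z) (β * X c z - α * dX c z)
      (hS.solution z)
    differentiable x hx := by
      have := hX.differentiable x hx
      have := hS.differentiable x hx
      fun_prop
    differentiable_deriv x hx := by
      have := hX.differentiable_deriv x hx
      have := hS.differentiable_deriv x hx
      fun_prop
    apply_self z := by linear_combination α * hW z
    deriv_self z := by linear_combination β * hW z }⟩

/-- The phase `z (x - s) - ∫ₛˣ p` of the leading exponentials of the pencil equation. -/
noncomputable def pencilPhase (p : ℝ → ℂ) (z : ℂ) (s x : ℝ) : ℂ := z * (x - s) - ∫ t in s..x, p t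

/-- The first order expression `y' - κ (z - p) y`. For `κ = ± i` its exponential part is
`exp (-κ * pencilPhase p z s x)`, and `y`, `y'` are recovered from the two values of `κ`. -/
noncomputable def pencilFactor (p : ℝ → ℂ) (z κ : ℂ) (y dy : ℝ → ℂ) (x : ℝ) : ℂ :=
  dy x - κ * (z - p x) * y x

/-- The potential that remains after the pencil operator is factored into the two first order
operators `d/dx ± κ (z - p)`. It does not depend on the spectral parameter. -/
noncomputable def factorPotential (p q : ℝ → ℂ) (κ : ℂ) (x : ℝ) : ℂ := p x ^ 2 + q x + κ * deriv p x

section Growth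

variable {T : ℝ} {p q : ℝ → ℂ} {z κ : ℂ} {y dy : ℝ → ℂ} {s x : ℝ}

theorem norm_integral_le_of_mem_Icc {E : Type*} [NormedAddCommGroup E] [NormedSpace ℝ E]
    {f : ℝ → E} (hf : IntervalIntegrable f volume 0 T) (hs : s ∈ Icc 0 T) (hx : x ∈ Icc 0 T) :
    ‖∫ t in s..x, f t‖ ≤ ∫ t in (0 : ℝ)..T, ‖f t‖ := by
  have hT : 0 ≤ T := hs.1.trans hs.2
  calc ‖∫ t in s..x, f t‖ ≤ |∫ t in s..x, ‖f t‖| :=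
        intervalIntegral.norm_integral_le_abs_integral_norm
    _ ≤ |∫ t in (0 : ℝ)..T, ‖f t‖| := intervalIntegral.abs_integral_mono_interval
        (uIoc_subset_uIoc_of_uIcc_subset_uIcc (uIcc_subset_uIcc (Icc_subset_uIcc hs)
          (Icc_subset_uIcc hx))) (.of_forall fun _ => norm_nonneg _) hf.norm
    _ = ∫ t in (0 : ℝ)..T, ‖f t‖ :=
        abs_of_nonneg (intervalIntegral.integral_nonneg hT fun _ _ => norm_nonneg _)

theorem abs_im_pencilPhase_le (hp : IntervalIntegrable p volume 0 T) (z : ℂ) (hs : s ∈ Icc 0 T)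
    (hx : x ∈ Icc 0 T) :
    |(pencilPhase p z s x).im| ≤ |z.im| * |x - s| + ∫ t in (0 : ℝ)..T, ‖p t‖ := by
  have him : (pencilPhase p z s x).im = z.im * (x - s) - (∫ t in s..x, p t).im := by
    simp [pencilPhase, ← Complex.ofReal_sub]
  rw [him, ← abs_mul]
  exact (abs_sub _ _).trans (add_le_add_right
    ((Complex.abs_im_le_norm _).trans (norm_integral_le_of_mem_Icc hp hs hx)) _)

theorem norm_exp_mul_le_of_sq_eq_neg_one (hκ : κ ^ 2 = -1) (w : ℂ) :
    ‖Complex.exp (κ * w)‖ ≤ Real.exp |w.im| := by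
  rw [Complex.norm_exp, Real.exp_le_exp]
  rcases sq_eq_sq_iff_eq_or_eq_neg.1 (hκ.trans Complex.I_sq.symm) with rfl | rfl
  · simpa using neg_le_abs w.im
  · simpa using le_abs_self w.im

theorem norm_exp_pencilPhase_le (hp : IntervalIntegrable p volume 0 T) (hκ : κ ^ 2 = -1)
    (hs : s ∈ Icc 0 T) (hx : x ∈ Icc 0 T) :
    ‖Complex.exp (-κ * pencilPhase p z s x)‖ ≤
      Real.exp (∫ t in (0 : ℝ)..T, ‖p t‖) * Real.exp (|z.im| * |x - s|) := by
  rw [← Real.exp_add, add_comm]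
  exact (norm_exp_mul_le_of_sq_eq_neg_one (by rwa [neg_sq]) _).trans
    (Real.exp_le_exp.2 (abs_im_pencilPhase_le hp z hs hx))

theorem hasDerivWithinAt_exp_pencilPhase (hp : ContinuousOn p (Icc 0 T)) (κ z : ℂ)
    (hx : x ∈ Icc 0 T) {t : ℝ} (ht : t ∈ Icc 0 T) :
    HasDerivWithinAt (fun t => Complex.exp (-κ * pencilPhase p z t x))
      (Complex.exp (-κ * pencilPhase p z t x) * (κ * (z - p t))) (Icc 0 T) t := by
  have hphase (t : ℝ) : pencilPhase p z t x = z * (x - t) + ∫ v in x..t, p v := by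
    rw [pencilPhase, intervalIntegral.integral_symm]
    ring
  have hid : HasDerivWithinAt (fun t : ℝ => (t : ℂ)) 1 (Icc 0 T) t :=
    Complex.ofRealCLM.hasDerivWithinAt
  simp only [hphase]
  refine ((((hid.const_sub (x : ℂ)).const_mul z).add
    (hasDerivWithinAt_integral_of_continuousOn hp hx ht)).const_mul (-κ)).cexp.congr_deriv ?_
  simp only [Pi.add_apply]
  ring

theorem intervalIntegrable_factorPotential (hp : AbsolutelyContinuousOnInterval p 0 T)
    (hq : IntervalIntegrable q volume 0 T) (κ : ℂ) :
    IntervalIntegrable (factorPotential p q κ) volume 0 T :=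
  ((hp.continuousOn.pow 2).intervalIntegrable.add hq).add
    ((intervalIntegrable_deriv_of_absolutelyContinuous hp).const_mul κ)

namespace IsPencilSolution

theorem absolutelyContinuous_pencilFactor (hT : 0 ≤ T)
    (hp : AbsolutelyContinuousOnInterval p 0 T) (h : IsPencilSolution T p q z y dy) (κ : ℂ) :
    AbsolutelyContinuousOnInterval (pencilFactor p z κ y dy) 0 T := by
  have hz : AbsolutelyContinuousOnInterval (fun _ : ℝ => z) 0 T :=
    (LipschitzWith.const z).lipschitzOnWith.absolutelyContinuousOnInterval
  exact h.absCont.fun_sub (((hz.fun_sub hp).const_smul κ).fun_smul (h.absolutelyContinuous hT))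

theorem ae_hasDerivAt_pencilFactor (hp : AbsolutelyContinuousOnInterval p 0 T)
    (h : IsPencilSolution T p q z y dy) (hκ : κ ^ 2 = -1) :
    ∀ᵐ x, x ∈ Icc 0 T → HasDerivAt (pencilFactor p z κ y dy)
      (factorPotential p q κ x * y x - κ * (z - p x) * pencilFactor p z κ y dy x) x := by
  filter_upwards [h.ae_hasDerivAt, h.ae_hasDerivAt_self,
    ae_hasDerivAt_of_absolutelyContinuous hp] with x hdy hy hp' hx
  refine ((hdy hx).sub ((((hp' (Icc_subset_uIcc hx)).const_sub z).const_mul κ).mul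
    (hy hx))).congr_deriv ?_
  simp only [pencilPotential, factorPotential, pencilFactor]
  linear_combination (-(z - p x) ^ 2 * y x) * hκ

theorem pencilFactor_eq (hp : AbsolutelyContinuousOnInterval p 0 T)
    (hq : IntervalIntegrable q volume 0 T) (h : IsPencilSolution T p q z y dy) (hκ : κ ^ 2 = -1)
    (hs : s ∈ Icc 0 T) (hx : x ∈ Icc 0 T) :
    pencilFactor p z κ y dy x =
      Complex.exp (-κ * pencilPhase p z s x) * pencilFactor p z κ y dy s +
        ∫ t in s..x, Complex.exp (-κ * pencilPhase p z t x) * (factorPotential p q κ t * y t) := by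
  have hT : 0 ≤ T := hs.1.trans hs.2
  have hpc : ContinuousOn p (uIcc 0 T) := hp.continuousOn
  rw [← sub_eq_iff_eq_add']
  have hexp := fun t ht => hasDerivWithinAt_exp_pencilPhase (T := T) (x := x) (t := t)
    (hpc.mono Icc_subset_uIcc) κ z hx ht
  rw [← uIcc_of_le hT] at hexp
  have hexpc : ContinuousOn (fun t => Complex.exp (-κ * pencilPhase p z t x)) (uIcc 0 T) :=
    fun t ht => (hexp t ht).continuousWithinAt
  have hac := (absolutelyContinuousOnInterval_of_hasDerivWithinAt hexp
    (hexpc.mul (continuousOn_const.mul (continuousOn_const.sub hpc)))).fun_smul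
      (h.absolutelyContinuous_pencilFactor hT hp κ)
  have hint := ((intervalIntegrable_factorPotential hp hq κ).mul_continuousOn
    (g := y) (by simpa only [uIcc_of_le hT] using h.continuousOn)).continuousOn_mul hexpc
  rw [integral_eq_sub_of_ae_hasDerivAt hac hint ?_ (Icc_subset_uIcc hs) (Icc_subset_uIcc hx)]
  · simp [pencilPhase]
  · filter_upwards [h.ae_hasDerivAt_pencilFactor hp hκ, ae_mem_uIcc_imp_uIcc_mem_nhds 0 T]
      with t hfactor hnhds ht
    refine (((hexp t ht).hasDerivAt (hnhds ht)).mul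
      (hfactor (by rwa [uIcc_of_le hT] at ht))).congr_deriv ?_
    ring

theorem norm_pencilFactor_sub_le (hp : AbsolutelyContinuousOnInterval p 0 T)
    (hq : IntervalIntegrable q volume 0 T) (h : IsPencilSolution T p q z y dy) (hκ : κ ^ 2 = -1)
    (hs : s ∈ Icc 0 T) (hx : x ∈ Icc 0 T) {M : ℝ}
    (hM : ∀ t ∈ Icc 0 T, ‖y t‖ ≤ M * Real.exp (|z.im| * |t - s|)) :
    ‖pencilFactor p z κ y dy x -
        Complex.exp (-κ * pencilPhase p z s x) * pencilFactor p z κ y dy s‖ ≤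
      Real.exp (∫ t in (0 : ℝ)..T, ‖p t‖) * Real.exp (|z.im| * |x - s|) *
        (M * ∫ t in (0 : ℝ)..T, ‖factorPotential p q κ t‖) := by
  set P := ∫ t in (0 : ℝ)..T, ‖p t‖
  set E := Real.exp (|z.im| * |x - s|)
  have hM₀ : 0 ≤ M := by simpa using (norm_nonneg _).trans (hM s hs)
  have hR := (intervalIntegrable_factorPotential hp hq κ).norm
  have hbound (t : ℝ) (ht : t ∈ uIcc s x) :
      ‖Complex.exp (-κ * pencilPhase p z t x) * (factorPotential p q κ t * y t)‖ ≤
        Real.exp P * E * M * ‖factorPotential p q κ t‖ := by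
    have htT : t ∈ Icc 0 T := ordConnected_Icc.uIcc_subset hs hx ht
    have hadd : E = Real.exp (|z.im| * |x - t|) * Real.exp (|z.im| * |t - s|) := by
      have hdist : |x - t| + |t - s| = |x - s| :=
        dist_add_dist_of_mem_segment (by rwa [segment_eq_uIcc, uIcc_comm])
      rw [← Real.exp_add, ← mul_add, hdist]
    rw [norm_mul, norm_mul]
    calc _ ≤ Real.exp P * Real.exp (|z.im| * |x - t|) *
          (‖factorPotential p q κ t‖ * (M * Real.exp (|z.im| * |t - s|))) := by
          gcongr
          · exact norm_exp_pencilPhase_le hp.continuousOn.intervalIntegrable hκ htT hx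
          · exact hM t htT
      _ = Real.exp P * E * M * ‖factorPotential p q κ t‖ := by rw [hadd]; ring
  rw [h.pencilFactor_eq hp hq hκ hs hx, add_sub_cancel_left]
  refine (intervalIntegral.norm_integral_le_abs_of_norm_le
    (ae_restrict_of_forall_mem measurableSet_uIoc fun t ht => hbound t (uIoc_subset_uIcc ht))
    ((hR.const_mul _).mono_set (uIcc_subset_uIcc (Icc_subset_uIcc hs)
      (Icc_subset_uIcc hx)))).trans ?_
  rw [intervalIntegral.integral_const_mul, abs_mul, abs_of_nonneg (by positivity), ← mul_assoc]
  gcongr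
  rw [← Real.norm_eq_abs]
  simpa only [norm_norm] using norm_integral_le_of_mem_Icc hR hs hx

theorem norm_pencilFactor_le (hp : AbsolutelyContinuousOnInterval p 0 T)
    (hq : IntervalIntegrable q volume 0 T) (h : IsPencilSolution T p q z y dy) (hκ : κ ^ 2 = -1)
    (hs : s ∈ Icc 0 T) (hx : x ∈ Icc 0 T) {M : ℝ}
    (hM : ∀ t ∈ Icc 0 T, ‖y t‖ ≤ M * Real.exp (|z.im| * |t - s|)) :
    ‖pencilFactor p z κ y dy x‖ ≤
      Real.exp (∫ t in (0 : ℝ)..T, ‖p t‖) * Real.exp (|z.im| * |x - s|) *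
        (‖pencilFactor p z κ y dy s‖ + M * ∫ t in (0 : ℝ)..T, ‖factorPotential p q κ t‖) := by
  have hexp := norm_exp_pencilPhase_le (z := z) hp.continuousOn.intervalIntegrable hκ hs hx
  rw [mul_add]
  refine (norm_le_norm_add_norm_sub' _ _).trans
    (add_le_add ?_ (h.norm_pencilFactor_sub_le hp hq hκ hs hx hM))
  rw [norm_mul]
  gcongr

end IsPencilSolution

theorem pencilFactor_I_sub (p : ℝ → ℂ) (z : ℂ) (y dy : ℝ → ℂ) (x : ℝ) :
    pencilFactor p z (-Complex.I) y dy x - pencilFactor p z Complex.I y dy x =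
      2 * Complex.I * ((z - p x) * y x) := by
  simp only [pencilFactor]
  ring

theorem pencilFactor_I_add (p : ℝ → ℂ) (z : ℂ) (y dy : ℝ → ℂ) (x : ℝ) :
    pencilFactor p z (-Complex.I) y dy x + pencilFactor p z Complex.I y dy x = 2 * dy x := by
  simp only [pencilFactor]
  ring

/-- How large the spectral parameter has to be for the perturbation estimates: `p` and the
remaining potential are then dominated by `z`, with `ρ` a bound for the latter in `L¹`. -/
structure IsLargeParameter (T : ℝ) (p q : ℝ → ℂ) (ρ : ℝ) (z : ℂ) : Prop where
  pos : 0 < ‖z‖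
  norm_coeff_le : ∀ x ∈ Icc 0 T, ‖p x‖ ≤ ‖z‖ / 2
  integral_le : ∀ κ : ℂ, κ ^ 2 = -1 → ∫ t in (0 : ℝ)..T, ‖factorPotential p q κ t‖ ≤ ρ
  exp_mul_le : 4 * Real.exp (∫ t in (0 : ℝ)..T, ‖p t‖) * ρ ≤ ‖z‖

theorem exists_eventually_isLargeParameter (hp : ContinuousOn p (Icc 0 T)) (q : ℝ → ℂ) :
    ∃ ρ, ∀ᶠ z in Bornology.cobounded ℂ, IsLargeParameter T p q ρ z := by
  obtain ⟨B, hB⟩ := isCompact_Icc.exists_bound_of_continuousOn hp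
  set ρ := max (∫ t in (0 : ℝ)..T, ‖factorPotential p q Complex.I t‖)
    (∫ t in (0 : ℝ)..T, ‖factorPotential p q (-Complex.I) t‖)
  refine ⟨ρ, ?_⟩
  filter_upwards [tendsto_norm_cobounded_atTop.eventually_gt_atTop 0,
    tendsto_norm_cobounded_atTop.eventually_ge_atTop (2 * B),
    tendsto_norm_cobounded_atTop.eventually_ge_atTop
      (4 * Real.exp (∫ t in (0 : ℝ)..T, ‖p t‖) * ρ)] with z hz hzB hzρ
  refine ⟨hz, fun x hx => (hB x hx).trans (by linarith), fun κ hκ => ?_, hzρ⟩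
  rcases sq_eq_sq_iff_eq_or_eq_neg.1 (hκ.trans Complex.I_sq.symm) with rfl | rfl
  · exact le_max_left _ _
  · exact le_max_right _ _

namespace IsPencilSolution

variable {ρ A : ℝ}

theorem norm_apply_le (hp : AbsolutelyContinuousOnInterval p 0 T)
    (hq : IntervalIntegrable q volume 0 T) (h : IsPencilSolution T p q z y dy)
    (hz : IsLargeParameter T p q ρ z) (hs : s ∈ Icc 0 T)
    (hA : ∀ κ, κ ^ 2 = -1 → ‖pencilFactor p z κ y dy s‖ ≤ A) (hx : x ∈ Icc 0 T) :
    ‖y x‖ ≤ 4 * Real.exp (∫ t in (0 : ℝ)..T, ‖p t‖) * A / ‖z‖ *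
      Real.exp (|z.im| * |x - s|) := by
  set P := Real.exp (∫ t in (0 : ℝ)..T, ‖p t‖)
  let e (t : ℝ) := Real.exp (|z.im| * |t - s|)
  obtain ⟨m, hm, hmax⟩ := isCompact_Icc.exists_isMaxOn ⟨s, hs⟩
    (h.continuousOn.norm.div (g := e) (by fun_prop) fun t _ => (Real.exp_pos _).ne')
  set M := ‖y m‖ / e m
  have hM (t : ℝ) (ht : t ∈ Icc 0 T) : ‖y t‖ ≤ M * e t :=
    (div_le_iff₀ (Real.exp_pos _)).1 (hmax ht)
  have hM₀ : 0 ≤ M := div_nonneg (norm_nonneg _) (Real.exp_pos _).le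
  have hfactor (κ : ℂ) (hκ : κ ^ 2 = -1) : ‖pencilFactor p z κ y dy m‖ ≤ P * e m * (A + M * ρ) :=
    (h.norm_pencilFactor_le hp hq hκ hs hm hM).trans (by
      gcongr
      · exact hA κ hκ
      · exact hz.integral_le κ hκ)
  have hzp : ‖z‖ / 2 ≤ ‖z - p m‖ := by
    linarith [norm_sub_norm_le z (p m), hz.norm_coeff_le m hm]
  have hmain : ‖z‖ / 2 * ‖y m‖ ≤ P * e m * (A + M * ρ) := by
    have hsub := norm_sub_le (pencilFactor p z (-Complex.I) y dy m)
      (pencilFactor p z Complex.I y dy m)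
    rw [pencilFactor_I_sub, norm_mul, norm_mul, norm_mul, Complex.norm_I, Complex.norm_two] at hsub
    linarith [hfactor Complex.I Complex.I_sq, hfactor (-Complex.I) (by simp),
      mul_le_mul_of_nonneg_right hzp (norm_nonneg (y m))]
  have hzM : ‖z‖ / 2 * M ≤ P * (A + M * ρ) := by
    rw [← mul_div_assoc, div_le_iff₀ (Real.exp_pos _)]
    linarith
  refine (hM x hx).trans (mul_le_mul_of_nonneg_right ?_ (Real.exp_pos _).le)
  rw [le_div_iff₀ hz.pos]
  linarith [mul_le_mul_of_nonneg_right hz.exp_mul_le hM₀]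

theorem norm_deriv_le (hp : AbsolutelyContinuousOnInterval p 0 T)
    (hq : IntervalIntegrable q volume 0 T) (h : IsPencilSolution T p q z y dy)
    (hz : IsLargeParameter T p q ρ z) (hs : s ∈ Icc 0 T)
    (hA : ∀ κ, κ ^ 2 = -1 → ‖pencilFactor p z κ y dy s‖ ≤ A) (hx : x ∈ Icc 0 T) :
    ‖dy x‖ ≤ 2 * Real.exp (∫ t in (0 : ℝ)..T, ‖p t‖) * A * Real.exp (|z.im| * |x - s|) := by
  set P := Real.exp (∫ t in (0 : ℝ)..T, ‖p t‖)
  set M := 4 * P * A / ‖z‖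
  have hA₀ : 0 ≤ A := (norm_nonneg _).trans (hA _ Complex.I_sq)
  have hM₀ : 0 ≤ M := by have := hz.pos; positivity
  have hMρ : M * ρ ≤ A := by
    rw [div_mul_eq_mul_div, div_le_iff₀ hz.pos]
    linarith [mul_le_mul_of_nonneg_right hz.exp_mul_le hA₀]
  have hfactor (κ : ℂ) (hκ : κ ^ 2 = -1) :
      ‖pencilFactor p z κ y dy x‖ ≤ P * Real.exp (|z.im| * |x - s|) * (A + A) :=
    (h.norm_pencilFactor_le hp hq hκ hs hx fun t => h.norm_apply_le hp hq hz hs hA).trans (by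
      gcongr
      · exact hA κ hκ
      · exact (mul_le_mul_of_nonneg_left (hz.integral_le κ hκ) hM₀).trans hMρ)
  have hadd := norm_add_le (pencilFactor p z (-Complex.I) y dy x)
    (pencilFactor p z Complex.I y dy x)
  rw [pencilFactor_I_add, norm_mul, Complex.norm_two] at hadd
  linarith [hfactor Complex.I Complex.I_sq, hfactor (-Complex.I) (by simp)]

theorem norm_mul_sub_sin_le (hp : AbsolutelyContinuousOnInterval p 0 T)
    (hq : IntervalIntegrable q volume 0 T) (h : IsPencilSolution T p q z y dy)
    (hz : IsLargeParameter T p q ρ z) (hs : s ∈ Icc 0 T) (hy : y s = 0) (hdy : dy s = 1)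
    (hx : x ∈ Icc 0 T) :
    ‖(z - p x) * y x - Complex.sin (pencilPhase p z s x)‖ ≤
      4 * Real.exp (∫ t in (0 : ℝ)..T, ‖p t‖) ^ 2 * ρ / ‖z‖ * Real.exp (|z.im| * |x - s|) := by
  set P := Real.exp (∫ t in (0 : ℝ)..T, ‖p t‖)
  set φ := pencilPhase p z s x
  have hfactor (κ : ℂ) : pencilFactor p z κ y dy s = 1 := by simp [pencilFactor, hy, hdy]
  have hdiff (κ : ℂ) (hκ : κ ^ 2 = -1) : ‖pencilFactor p z κ y dy x - Complex.exp (-κ * φ)‖ ≤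
      P * Real.exp (|z.im| * |x - s|) * (4 * P * 1 / ‖z‖ * ρ) := by
    have hle := h.norm_pencilFactor_sub_le hp hq hκ hs hx fun t =>
      h.norm_apply_le hp hq hz hs fun κ _ => (congrArg norm (hfactor κ)).le.trans norm_one.le
    rw [hfactor, mul_one] at hle
    refine hle.trans ?_
    gcongr
    exact hz.integral_le κ hκ
  have hsin : 2 * Complex.I * ((z - p x) * y x - Complex.sin φ) =
      (pencilFactor p z (-Complex.I) y dy x - Complex.exp (-(-Complex.I) * φ)) -
        (pencilFactor p z Complex.I y dy x - Complex.exp (-Complex.I * φ)) := by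
    rw [sub_sub_sub_comm, pencilFactor_I_sub, Complex.sin, neg_neg, mul_comm Complex.I φ,
      show -Complex.I * φ = -φ * Complex.I by ring]
    linear_combination -(Complex.exp (-φ * Complex.I) - Complex.exp (φ * Complex.I)) *
      Complex.I_sq
  have hle := norm_sub_le (pencilFactor p z (-Complex.I) y dy x - Complex.exp (-(-Complex.I) * φ))
    (pencilFactor p z Complex.I y dy x - Complex.exp (-Complex.I * φ))
  rw [← hsin, norm_mul, norm_mul, Complex.norm_I, Complex.norm_two] at hle
  calc ‖(z - p x) * y x - Complex.sin φ‖
      ≤ P * Real.exp (|z.im| * |x - s|) * (4 * P * 1 / ‖z‖ * ρ) := by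
        linarith [hdiff Complex.I Complex.I_sq, hdiff (-Complex.I) (by simp)]
    _ = 4 * P ^ 2 * ρ / ‖z‖ * Real.exp (|z.im| * |x - s|) := by ring

end IsPencilSolution

end Growth

section SineType

open Asymptotics Bornology Filter Topology

/-- The function `exp (σ |Im z|) / |z| ^ k`, to which entire functions of exponential type are
compared as `|z|` tends to infinity. -/
noncomputable def expWeight (k : ℕ) (σ : ℝ) (z : ℂ) : ℝ := Real.exp (σ * |z.im|) / ‖z‖ ^ k

theorem expWeight_mul (k l : ℕ) (σ τ : ℝ) (z : ℂ) :
    expWeight k σ z * expWeight l τ z = expWeight (k + l) (σ + τ) z := by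
  rw [expWeight, expWeight, expWeight, div_mul_div_comm, ← Real.exp_add, ← add_mul, ← pow_add]

theorem expWeight_nonneg (k : ℕ) (σ : ℝ) (z : ℂ) : 0 ≤ expWeight k σ z := by
  unfold expWeight; positivity

theorem isBigO_mul_expWeight {f g : ℂ → ℂ} {k l : ℕ} {σ τ : ℝ}
    (hf : f =O[cobounded ℂ] expWeight k σ) (hg : g =O[cobounded ℂ] expWeight l τ) :
    (fun z => f z * g z) =O[cobounded ℂ] expWeight (k + l) (σ + τ) := by
  simpa only [expWeight_mul] using hf.mul hg

theorem isBigO_self_mul_expWeight_iff {f : ℂ → ℂ} {k : ℕ} {σ : ℝ} :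
    (fun z => z * f z) =O[cobounded ℂ] expWeight k σ ↔
      f =O[cobounded ℂ] expWeight (k + 1) σ := by
  simp only [isBigO_iff]
  refine exists_congr fun C => eventually_congr ?_
  filter_upwards [eventually_ne_cobounded 0] with z hz
  rw [norm_mul, Real.norm_of_nonneg (expWeight_nonneg _ _ _),
    Real.norm_of_nonneg (expWeight_nonneg _ _ _), expWeight, expWeight, pow_succ, ← div_div,
    ← mul_div_assoc, ← mul_div_assoc, ← mul_div_assoc, le_div_iff₀ (norm_pos_iff.2 hz), mul_comm]

theorem isBigO_expWeight_of_le {f : ℂ → ℂ} {k l : ℕ} (hkl : k ≤ l) {σ : ℝ}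
    (hf : f =O[cobounded ℂ] expWeight l σ) : f =O[cobounded ℂ] expWeight k σ := by
  refine hf.trans (IsBigO.of_bound 1 ?_)
  filter_upwards [tendsto_norm_cobounded_atTop.eventually_ge_atTop 1] with z hz
  rw [one_mul, Real.norm_of_nonneg (expWeight_nonneg _ _ _),
    Real.norm_of_nonneg (expWeight_nonneg _ _ _), expWeight, expWeight]
  gcongr

theorem norm_sin_sq (w : ℂ) :
    ‖Complex.sin w‖ ^ 2 = Real.cosh w.im ^ 2 - Real.cos w.re ^ 2 := by
  have hsin : Complex.sin w = ((Real.sin w.re * Real.cosh w.im : ℝ) : ℂ) +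
      ((Real.cos w.re * Real.sinh w.im : ℝ) : ℂ) * Complex.I := by
    rw [Complex.sin_eq]
    push_cast
    ring
  rw [hsin, Complex.norm_add_mul_I, Real.sq_sqrt (by positivity), mul_pow, mul_pow, Real.sin_sq,
    Real.cosh_sq]
  ring

theorem norm_sin_le (w : ℂ) : ‖Complex.sin w‖ ≤ Real.exp |w.im| := by
  refine le_of_sq_le_sq ?_ (Real.exp_pos _).le
  have hcosh : Real.cosh w.im ≤ Real.exp |w.im| := by
    rw [← Real.cosh_abs, Real.cosh_eq]
    linarith [Real.exp_le_exp.2 (neg_le_self (abs_nonneg w.im))]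
  rw [norm_sin_sq]
  nlinarith [sq_nonneg (Real.cos w.re), Real.cosh_pos w.im]

theorem exp_abs_im_div_four_le_norm_sin {w : ℂ} (hw : Real.cos w.re = 0 ∨ 1 ≤ |w.im|) :
    Real.exp |w.im| / 4 ≤ ‖Complex.sin w‖ := by
  refine le_of_sq_le_sq ?_ (norm_nonneg _)
  have hcosh : Real.exp |w.im| / 2 ≤ Real.cosh w.im := by
    rw [← Real.cosh_abs, Real.cosh_eq]
    linarith [Real.exp_pos (-|w.im|)]
  have hexp : 0 < Real.exp |w.im| := Real.exp_pos _
  rw [norm_sin_sq]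
  rcases hw with hcos | him
  · rw [hcos]
    nlinarith
  · have he : 2.7 < Real.exp |w.im| := by
      linarith [Real.exp_one_gt_d9, Real.exp_le_exp.2 him]
    nlinarith [Real.cos_sq_le_one w.re]

theorem apply_eq_apply_of_frequently_norm_le {g : ℂ → ℂ} (hg : Differentiable ℂ g) {M : ℝ}
    (hM : ∃ᶠ L in atTop, ∀ v : ℂ, max |v.re| |v.im| = L → ‖g v‖ ≤ M) (z w : ℂ) : g z = g w := by
  have hcont : Continuous fun v : ℂ => max |v.re| |v.im| := by fun_prop
  have hbound (v : ℂ) : ‖g v‖ ≤ M := by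
    obtain ⟨L, hL, hvL⟩ := (hM.and_eventually (eventually_gt_atTop ‖v‖)).exists
    have hbdd : IsBounded {u : ℂ | max |u.re| |u.im| < L} := by
      refine (Metric.isBounded_ball (x := (0 : ℂ)) (r := L + L)).subset fun u hu => ?_
      rw [mem_ball_zero_iff]
      exact (Complex.norm_le_abs_re_add_abs_im u).trans_lt
        (add_lt_add (lt_of_le_of_lt (le_max_left _ _) hu) (lt_of_le_of_lt (le_max_right _ _) hu))
    refine Complex.norm_le_of_forall_mem_frontier_norm_le hbdd hg.diffContOnCl
      (fun u hu => hL u (frontier_lt_subset_eq hcont continuous_const hu)) (subset_closure ?_)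
    exact max_lt ((Complex.abs_re_le_norm v).trans_lt hvL) ((Complex.abs_im_le_norm v).trans_lt hvL)
  refine hg.apply_eq_apply_of_bounded (isBounded_iff_forall_norm_le.2 ⟨M, ?_⟩) z w
  rintro _ ⟨v, rfl⟩
  exact hbound v

/-- Entire functions of sine type, in the normalization `z D(z) = sin (z ℓ - ω) + O(...)` that
occurs for characteristic functions of Dirichlet problems on an interval of length `|ℓ|`. -/
structure IsSineType (D : ℂ → ℂ) (ℓ : ℝ) (ω : ℂ) : Prop where
  differentiable : Differentiable ℂ D
  isBigO_sub : (fun z => z * D z - Complex.sin (z * ℓ - ω)) =O[cobounded ℂ] expWeight 1 |ℓ|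

theorem abs_mul_abs_im_le (z ω : ℂ) (ℓ : ℝ) :
    |(|ℓ| * |z.im| - |(z * ℓ - ω).im|)| ≤ |ω.im| := by
  have him : (z * ℓ - ω).im = ℓ * z.im - ω.im := by simp [mul_comm]
  rw [him, ← abs_mul]
  simpa using abs_abs_sub_abs_le (ℓ * z.im) (ℓ * z.im - ω.im)

theorem isBigO_sin_expWeight (ℓ : ℝ) (ω : ℂ) :
    (fun z : ℂ => Complex.sin (z * ℓ - ω)) =O[cobounded ℂ] expWeight 0 |ℓ| := by
  refine IsBigO.of_bound (Real.exp |ω.im|) (Eventually.of_forall fun z => ?_)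
  refine (norm_sin_le _).trans ?_
  rw [Real.norm_of_nonneg (expWeight_nonneg _ _ _), expWeight, pow_zero, div_one, ← Real.exp_add]
  gcongr
  linarith [(abs_le.1 (abs_mul_abs_im_le z ω ℓ)).1]

/-- The set where `|sin (z ℓ - ω)|` is comparable to `exp (|ℓ| |Im z|)`; it contains the sides of
arbitrarily large squares. -/
def awayFromZeros (ℓ : ℝ) (ω : ℂ) : Set ℂ :=
  {z | Real.cos (z * ℓ - ω).re = 0 ∨ 1 ≤ |(z * ℓ - ω).im|}

theorem expWeight_isBigO_sin (ℓ : ℝ) (ω : ℂ) :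
    expWeight 0 |ℓ| =O[𝓟 (awayFromZeros ℓ ω)] fun z : ℂ => Complex.sin (z * ℓ - ω) := by
  refine IsBigO.of_bound (4 * Real.exp |ω.im|) (eventually_principal.2 fun z hz => ?_)
  rw [Real.norm_of_nonneg (expWeight_nonneg _ _ _), expWeight, pow_zero, div_one]
  calc Real.exp (|ℓ| * |z.im|) ≤ Real.exp (|ω.im| + |(z * ℓ - ω).im|) := by
        gcongr
        linarith [(abs_le.1 (abs_mul_abs_im_le z ω ℓ)).2]
    _ = 4 * Real.exp |ω.im| * (Real.exp |(z * ℓ - ω).im| / 4) := by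
        rw [Real.exp_add]
        ring
    _ ≤ 4 * Real.exp |ω.im| * ‖Complex.sin (z * ℓ - ω)‖ := by
        gcongr
        exact exp_abs_im_div_four_le_norm_sin hz

theorem expWeight_succ_isLittleO (k : ℕ) (σ : ℝ) :
    expWeight (k + 1) σ =o[cobounded ℂ] expWeight k σ := by
  have hinv : (fun z : ℂ => ‖z‖⁻¹) =o[cobounded ℂ] fun _ => (1 : ℝ) :=
    (isLittleO_one_iff ℝ).2 tendsto_norm_cobounded_atTop.inv_tendsto_atTop
  refine ((isBigO_refl (expWeight k σ) (cobounded ℂ)).mul_isLittleO hinv).congr (fun z => ?_)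
    fun z => mul_one _
  rw [expWeight, expWeight, pow_succ, ← div_div, div_eq_mul_inv _ ‖z‖]

theorem tendsto_add_div_cobounded (ω : ℂ) {ℓ : ℝ} (hℓ : ℓ ≠ 0) :
    Tendsto (fun v : ℂ => (v + ω) / ℓ) (cobounded ℂ) (cobounded ℂ) := by
  simp only [div_eq_mul_inv]
  exact (tendsto_mul_right_cobounded (inv_ne_zero (Complex.ofReal_ne_zero.2 hℓ))).comp
    (tendsto_add_const_cobounded ω)

theorem frequently_max_abs_eq_imp_mem_awayFromZeros {ℓ : ℝ} (hℓ : ℓ ≠ 0) (ω : ℂ) :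
    ∃ᶠ L : ℝ in atTop, ∀ v : ℂ, max |v.re| |v.im| = L → (v + ω) / ℓ ∈ awayFromZeros ℓ ω := by
  have hlim : Tendsto (fun n : ℕ => Real.pi / 2 + n * Real.pi) atTop atTop :=
    tendsto_atTop_add_const_left _ _
      (tendsto_natCast_atTop_atTop.atTop_mul_const Real.pi_pos)
  refine hlim.frequently (Eventually.frequently (Eventually.of_forall fun n v hv => ?_))
  have hcancel : (v + ω) / ℓ * ℓ - ω = v := by
    rw [div_mul_cancel₀ _ (Complex.ofReal_ne_zero.2 hℓ), add_sub_cancel_right]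
  rw [awayFromZeros, mem_ofPred_eq, hcancel]
  rcases max_choice |v.re| |v.im| with h | h <;> rw [h] at hv
  · left
    rw [← Real.cos_abs, hv, Real.cos_add_nat_mul_pi, Real.cos_pi_div_two, mul_zero]
  · right
    rw [hv]
    have : 0 ≤ n * Real.pi := by positivity
    linarith [Real.pi_gt_three]

namespace IsSineType

variable {D : ℂ → ℂ} {ℓ : ℝ} {ω : ℂ}

theorem isBigO (hD : IsSineType D ℓ ω) : D =O[cobounded ℂ] expWeight 1 |ℓ| := by
  refine isBigO_self_mul_expWeight_iff.1 ?_
  simpa using (isBigO_expWeight_of_le zero_le_one hD.isBigO_sub).add (isBigO_sin_expWeight ℓ ω)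

theorem expWeight_isBigO (hD : IsSineType D ℓ ω) :
    expWeight 0 |ℓ| =O[cobounded ℂ ⊓ 𝓟 (awayFromZeros ℓ ω)] fun z => z * D z := by
  have hsin := (expWeight_isBigO_sin ℓ ω).mono (inf_le_right (a := cobounded ℂ))
  have hlittle := (hD.isBigO_sub.trans_isLittleO (expWeight_succ_isLittleO 0 |ℓ|)).mono
    (inf_le_left (b := 𝓟 (awayFromZeros ℓ ω)))
  refine hsin.trans ?_
  simpa using (hlittle.trans_isBigO hsin).right_isBigO_add

theorem isBigO_one_of_mul (hD : IsSineType D ℓ ω) {r : ℂ → ℂ}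
    (hDr : (fun z => D z * r z) =O[cobounded ℂ] expWeight 1 |ℓ|) :
    r =O[cobounded ℂ ⊓ 𝓟 (awayFromZeros ℓ ω)] fun _ => (1 : ℝ) := by
  obtain ⟨C, hC⟩ := (((isBigO_self_mul_expWeight_iff.2 hDr).mono inf_le_left).trans
    hD.expWeight_isBigO).bound
  obtain ⟨C', hC'⟩ := hD.expWeight_isBigO.bound
  have hne := (eventually_ne_cobounded (0 : ℂ)).filter_mono
    (inf_le_left (b := 𝓟 (awayFromZeros ℓ ω)))
  refine IsBigO.of_bound C ?_
  filter_upwards [hC, hC', hne] with z hz hz' hz₀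
  have hweight : 0 < expWeight 0 |ℓ| z := by
    simpa [expWeight] using Real.exp_pos _
  have hpos : 0 < ‖z * D z‖ := norm_pos_iff.2 fun h => by
    rw [h, norm_zero, mul_zero, norm_le_zero_iff] at hz'
    exact hweight.ne' hz'
  rw [← mul_assoc, norm_mul] at hz
  rw [norm_one, mul_one]
  exact le_of_mul_le_mul_left (hz.trans_eq (mul_comm _ _)) hpos

theorem apply_eq_apply_of_isBigO (hD : IsSineType D ℓ ω) (hℓ : ℓ ≠ 0) {r : ℂ → ℂ}
    (hr : Differentiable ℂ r) (hDr : (fun z => D z * r z) =O[cobounded ℂ] expWeight 1 |ℓ|)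
    (z w : ℂ) : r z = r w := by
  obtain ⟨M, hM⟩ := isBigO_iff.1 (hD.isBigO_one_of_mul hDr)
  rw [eventually_inf_principal] at hM
  have hM' := (tendsto_add_div_cobounded ω hℓ).eventually hM
  obtain ⟨R, -, hR⟩ := hasBasis_cobounded_norm.eventually_iff.1 hM'
  have hℓ₀ : (ℓ : ℂ) ≠ 0 := Complex.ofReal_ne_zero.2 hℓ
  have hconst := apply_eq_apply_of_frequently_norm_le (g := fun v => r ((v + ω) / ℓ)) (M := M)
    (by fun_prop) (((frequently_max_abs_eq_imp_mem_awayFromZeros hℓ ω).and_eventually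
      (eventually_ge_atTop R)).mono fun L ⟨hL, hRL⟩ v hv => ?_) (z * ℓ - ω) (w * ℓ - ω)
  · simpa [hℓ₀] using hconst
  · have hRv : R ≤ ‖v‖ := by
      rw [← hv] at hRL
      exact hRL.trans (max_le (Complex.abs_re_le_norm v) (Complex.abs_im_le_norm v))
    simpa using hR hRv (hL v hv)

theorem eq_zero_of_isBigO (hD : IsSineType D ℓ ω) (hℓ : ℓ ≠ 0) {r : ℂ → ℂ}
    (hr : Differentiable ℂ r) (hDr : (fun z => D z * r z) =O[cobounded ℂ] expWeight 2 |ℓ|)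
    (z : ℂ) : r z = 0 := by
  have hzr := hD.apply_eq_apply_of_isBigO hℓ (r := fun z => z * r z) (by fun_prop)
    ((isBigO_self_mul_expWeight_iff.2 hDr).congr_left fun z => by ring) 1 0
  rw [hD.apply_eq_apply_of_isBigO hℓ hr (isBigO_expWeight_of_le one_le_two hDr) z 1]
  simpa using hzr

theorem tendsto_mul_apply (hD : IsSineType D ℓ ω) (hℓ : ℓ ≠ 0) (w : ℂ) :
    Tendsto (fun n : ℕ => (w + n * (2 * Real.pi)) / ℓ * D ((w + n * (2 * Real.pi)) / ℓ)) atTop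
      (𝓝 (Complex.sin (w - ω))) := by
  have hℓ₀ : (ℓ : ℂ) ≠ 0 := Complex.ofReal_ne_zero.2 hℓ
  set v : ℕ → ℂ := fun n => (w + n * (2 * Real.pi)) / ℓ
  have hv : Tendsto v atTop (cobounded ℂ) := by
    have hnat : Tendsto (fun n : ℕ => (n : ℂ) * (2 * Real.pi)) atTop (cobounded ℂ) := by
      rw [← tendsto_norm_atTop_iff_cobounded]
      simpa [abs_of_pos Real.pi_pos] using
        (tendsto_natCast_atTop_atTop (R := ℝ)).atTop_mul_const Real.two_pi_pos
    simpa [v, Function.comp_def, add_comm] using (tendsto_add_div_cobounded w hℓ).comp hnat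
  have hsin (n : ℕ) : Complex.sin (v n * ℓ - ω) = Complex.sin (w - ω) := by
    rw [div_mul_cancel₀ _ hℓ₀, add_sub_right_comm, Complex.sin_add_nat_mul_two_pi]
  have him (n : ℕ) : expWeight 0 |ℓ| (v n) = Real.exp |w.im| := by
    have hmul := congrArg Complex.im (div_mul_cancel₀ (w + n * (2 * Real.pi)) hℓ₀)
    rw [Complex.im_mul_ofReal] at hmul
    rw [expWeight, ← abs_mul, mul_comm, hmul]
    simp
  have hlim := (hD.isBigO_sub.trans_isLittleO (expWeight_succ_isLittleO 0 |ℓ|)).comp_tendsto hv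
  simp only [Function.comp_def, hsin, him] at hlim
  simpa using ((isLittleO_const_iff (Real.exp_pos _).ne').1 hlim).add_const (Complex.sin (w - ω))

theorem exists_ne_zero (hD : IsSineType D ℓ ω) (hℓ : ℓ ≠ 0) : ∃ z, D z ≠ 0 := by
  by_contra! hzero
  have hlim := hD.tendsto_mul_apply hℓ (Real.pi / 2 + ω)
  simp only [hzero, mul_zero, add_sub_cancel_right, Complex.sin_pi_div_two] at hlim
  exact zero_ne_one (tendsto_nhds_unique tendsto_const_nhds hlim)

theorem sin_sub_eq_of_eq_mul {D' : ℂ → ℂ} {ω' c : ℂ} (hD : IsSineType D ℓ ω)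
    (hD' : IsSineType D' ℓ ω') (hℓ : ℓ ≠ 0) (hc : ∀ z, D' z = c * D z) (w : ℂ) :
    Complex.sin (w - ω') = c * Complex.sin (w - ω) := by
  refine tendsto_nhds_unique (hD'.tendsto_mul_apply hℓ w)
    (((hD.tendsto_mul_apply hℓ w).const_mul c).congr fun n => ?_)
  rw [hc]
  ring

theorem sq_eq_one_and_exp_eq_of_eq_mul {D' : ℂ → ℂ} {ω' c : ℂ} (hD : IsSineType D ℓ ω)
    (hD' : IsSineType D' ℓ ω') (hℓ : ℓ ≠ 0) (hc : ∀ z, D' z = c * D z) :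
    c ^ 2 = 1 ∧ Complex.exp (Complex.I * (ω' - ω)) = c := by
  have hsin : Complex.sin (ω' - ω) = 0 := by
    have h := hD.sin_sub_eq_of_eq_mul hD' hℓ hc ω
    rw [sub_self, Complex.sin_zero, mul_zero] at h
    rw [← neg_sub, Complex.sin_neg, h, neg_zero]
  have hcos : Complex.cos (ω' - ω) = c := by
    have h := hD.sin_sub_eq_of_eq_mul hD' hℓ hc (Real.pi / 2 + ω)
    rwa [add_sub_cancel_right, Complex.sin_pi_div_two, mul_one, add_sub_assoc, add_comm,
      Complex.sin_add_pi_div_two, ← Complex.cos_neg, neg_sub] at h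
  refine ⟨?_, ?_⟩
  · rw [← hcos, ← Complex.sin_sq_add_cos_sq (ω' - ω), hsin]
    ring
  · rw [mul_comm, Complex.exp_mul_I, hsin, hcos, zero_mul, add_zero]

end IsSineType

namespace IsPencilFamily

variable {T c x : ℝ} {p q : ℝ → ℂ} {S dS : ℝ → ℂ → ℂ}

theorem pencilFactor_self (hS : IsPencilFamily T p q c 0 1 S dS) (z κ : ℂ) :
    pencilFactor p z κ (S · z) (dS · z) c = 1 := by
  simp [pencilFactor, hS.apply_self, hS.deriv_self]

theorem isBigO_apply (hS : IsPencilFamily T p q c 0 1 S dS)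
    (hp : AbsolutelyContinuousOnInterval p 0 T) (hq : IntervalIntegrable q volume 0 T)
    (hc : c ∈ Icc 0 T) (hx : x ∈ Icc 0 T) : S x =O[cobounded ℂ] expWeight 1 |x - c| := by
  obtain ⟨ρ, hρ⟩ := exists_eventually_isLargeParameter (hp.continuousOn.mono Icc_subset_uIcc) q
  refine IsBigO.of_bound (4 * Real.exp (∫ t in (0 : ℝ)..T, ‖p t‖)) (hρ.mono fun z hz => ?_)
  refine ((hS.solution z).norm_apply_le hp hq hz hc (A := 1) (fun κ _ => ?_) hx).trans_eq ?_
  · rw [hS.pencilFactor_self, norm_one]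
  · rw [Real.norm_of_nonneg (expWeight_nonneg _ _ _), expWeight, mul_comm |z.im|]
    ring

theorem isBigO_deriv (hS : IsPencilFamily T p q c 0 1 S dS)
    (hp : AbsolutelyContinuousOnInterval p 0 T) (hq : IntervalIntegrable q volume 0 T)
    (hc : c ∈ Icc 0 T) (hx : x ∈ Icc 0 T) : dS x =O[cobounded ℂ] expWeight 0 |x - c| := by
  obtain ⟨ρ, hρ⟩ := exists_eventually_isLargeParameter (hp.continuousOn.mono Icc_subset_uIcc) q
  refine IsBigO.of_bound (2 * Real.exp (∫ t in (0 : ℝ)..T, ‖p t‖)) (hρ.mono fun z hz => ?_)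
  refine ((hS.solution z).norm_deriv_le hp hq hz hc (A := 1) (fun κ _ => ?_) hx).trans_eq ?_
  · rw [hS.pencilFactor_self, norm_one]
  · rw [Real.norm_of_nonneg (expWeight_nonneg _ _ _), expWeight, mul_comm |z.im|]
    ring

theorem isSineType (hS : IsPencilFamily T p q c 0 1 S dS)
    (hp : AbsolutelyContinuousOnInterval p 0 T) (hq : IntervalIntegrable q volume 0 T)
    (hc : c ∈ Icc 0 T) (hx : x ∈ Icc 0 T) : IsSineType (S x) (x - c) (∫ t in c..x, p t) := by
  obtain ⟨ρ, hρ⟩ := exists_eventually_isLargeParameter (hp.continuousOn.mono Icc_subset_uIcc) q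
  have hsin : (fun z => (z - p x) * S x z - Complex.sin (z * ((x - c : ℝ) : ℂ) - ∫ t in c..x, p t))
      =O[cobounded ℂ] expWeight 1 |x - c| := by
    refine IsBigO.of_bound (4 * Real.exp (∫ t in (0 : ℝ)..T, ‖p t‖) ^ 2 * ρ)
      (hρ.mono fun z hz => ?_)
    rw [Complex.ofReal_sub]
    refine ((hS.solution z).norm_mul_sub_sin_le hp hq hz hc (hS.apply_self z) (hS.deriv_self z)
      hx).trans_eq ?_
    rw [Real.norm_of_nonneg (expWeight_nonneg _ _ _), expWeight, mul_comm |z.im|]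
    ring
  exact ⟨hS.differentiable x hx, (hsin.add ((hS.isBigO_apply hp hq hc hx).const_mul_left (p x))
    ).congr_left fun z => by ring⟩

end IsPencilFamily

end SineType

section EntireQuotient

open Filter Topology

theorem analyticOrderAt_ne_top_of_differentiable {g : ℂ → ℂ} (hg : Differentiable ℂ g)
    (hg₀ : ∃ z, g z ≠ 0) (z : ℂ) : analyticOrderAt g z ≠ ⊤ := by
  obtain ⟨w, hw⟩ := hg₀
  have hgan : AnalyticOnNhd ℂ g univ := fun u _ => hg.analyticAt u
  refine hgan.analyticOrderAt_ne_top_of_isPreconnected isPreconnected_univ (mem_univ w)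
    (mem_univ z) ?_
  rw [(hg.analyticAt w).analyticOrderAt_eq_zero.2 hw]
  exact ENat.zero_ne_top

theorem eq_zero_of_differentiable_of_mul_eq_zero {u r : ℂ → ℂ} (hu : Differentiable ℂ u)
    (hr : Differentiable ℂ r) (hu₀ : ∃ z, u z ≠ 0) (h : ∀ z, u z * r z = 0) (z : ℂ) :
    r z = 0 := by
  obtain ⟨w, hw⟩ := hu₀
  rcases AnalyticOnNhd.eq_zero_or_eq_zero_of_mul_eq_zero (fun v _ => hu.analyticAt v)
    (fun v _ => hr.analyticAt v) (fun v _ => h v) isPreconnected_univ with hzero | hzero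
  · exact absurd (hzero w (mem_univ w)) hw
  · exact hzero z (mem_univ z)

theorem meromorphicOrderAt_div_nonneg {f g : ℂ → ℂ} {z : ℂ} (hf : AnalyticAt ℂ f z)
    (hg : AnalyticAt ℂ g z) (hgt : analyticOrderAt g z ≠ ⊤)
    (hle : analyticOrderAt g z ≤ analyticOrderAt f z) : 0 ≤ meromorphicOrderAt (f / g) z := by
  rw [meromorphicOrderAt_div hf.meromorphicAt hg.meromorphicAt, hf.meromorphicOrderAt_eq,
    hg.meromorphicOrderAt_eq]
  obtain ⟨n, hn⟩ := ENat.ne_top_iff_exists.1 hgt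
  rw [← hn] at hle ⊢
  cases h : analyticOrderAt f z with
  | top => simp
  | coe m =>
    rw [h, Nat.cast_le] at hle
    simp only [ENat.map_natCast]
    norm_cast
    omega

theorem exists_differentiable_eq_mul {f g : ℂ → ℂ} (hf : Differentiable ℂ f)
    (hg : Differentiable ℂ g) (hg₀ : ∃ z, g z ≠ 0)
    (hle : ∀ z, analyticOrderAt g z ≤ analyticOrderAt f z) :
    ∃ r : ℂ → ℂ, Differentiable ℂ r ∧ ∀ z, f z = r z * g z := by
  have htop := analyticOrderAt_ne_top_of_differentiable hg hg₀
  have hmero : MeromorphicOn (f / g) univ := fun z _ =>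
    (hf.analyticAt z).meromorphicAt.div (hg.analyticAt z).meromorphicAt
  set r := toMeromorphicNFOn (f / g) univ
  have hr (z : ℂ) : AnalyticAt ℂ r z := by
    refine (meromorphicNFOn_toMeromorphicNFOn (f / g) univ
      (mem_univ z)).meromorphicOrderAt_nonneg_iff_analyticAt.1 ?_
    rw [meromorphicOrderAt_toMeromorphicNFOn hmero (mem_univ z)]
    exact meromorphicOrderAt_div_nonneg (hf.analyticAt z) (hg.analyticAt z) (htop z) (hle z)
  refine ⟨r, fun z => (hr z).differentiableAt, fun z => ?_⟩
  have hne : ∀ᶠ w in 𝓝[≠] z, g w ≠ 0 :=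
    (hg.analyticAt z).eventually_eq_zero_or_eventually_ne_zero.resolve_left fun hzero =>
      htop z (analyticOrderAt_eq_top.2 hzero)
  have heq : f =ᶠ[𝓝[≠] z] fun w => r w * g w := by
    filter_upwards [hmero.toMeromorphicNFOn_eq_self_on_nhdsNE (mem_univ z), hne] with w hrw hgw
    rw [show r w = (f / g) w from hrw, Pi.div_apply, div_mul_cancel₀ _ hgw]
  exact (((hf z).continuousAt.eventuallyEq_nhds_iff_eventuallyEq_nhdsNE
    ((hr z).continuousAt.mul (hg z).continuousAt)).1 heq).self_of_nhds

theorem exists_differentiable_of_mul_eq_mul {u w N G : ℂ → ℂ} (hu : Differentiable ℂ u)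
    (hw : Differentiable ℂ w) (hN : Differentiable ℂ N) (hG : Differentiable ℂ G)
    (hu₀ : ∃ z, u z ≠ 0) (hcop : ∀ z, u z = 0 → w z ≠ 0) (h : ∀ z, w z * N z = u z * G z) :
    ∃ F : ℂ → ℂ, Differentiable ℂ F ∧ (∀ z, N z = F z * u z) ∧ ∀ z, G z = F z * w z := by
  obtain ⟨F, hF, hNF⟩ := exists_differentiable_eq_mul hN hu hu₀ fun z => by
    by_cases hz : u z = 0
    · have horder := congrArg (analyticOrderAt · z) (funext h : w * N = u * G)
      simp only [analyticOrderAt_mul (hw.analyticAt z) (hN.analyticAt z),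
        analyticOrderAt_mul (hu.analyticAt z) (hG.analyticAt z),
        (hw.analyticAt z).analyticOrderAt_eq_zero.2 (hcop z hz), zero_add] at horder
      rw [horder]
      exact le_self_add
    · rw [(hu.analyticAt z).analyticOrderAt_eq_zero.2 hz]
      exact zero_le
  refine ⟨F, hF, hNF, fun z => sub_eq_zero.1 (eq_zero_of_differentiable_of_mul_eq_zero hu
    (r := fun z => G z - F z * w z) (by fun_prop) hu₀ (fun z => ?_) z)⟩
  linear_combination w z * hNF z - h z

theorem IsSineType.exists_eq_mul {D D' : ℂ → ℂ} {ℓ : ℝ} {ω ω' : ℂ} (hD : IsSineType D ℓ ω)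
    (hD' : IsSineType D' ℓ ω') (hℓ : ℓ ≠ 0)
    (hle : ∀ z, analyticOrderAt D z ≤ analyticOrderAt D' z) : ∃ c, ∀ z, D' z = c * D z := by
  obtain ⟨r, hr, hrD⟩ := exists_differentiable_eq_mul hD'.differentiable hD.differentiable
    (hD.exists_ne_zero hℓ) hle
  refine ⟨r 0, fun z => ?_⟩
  rw [hrD, hD.apply_eq_apply_of_isBigO hℓ hr
    (hD'.isBigO.congr_left fun z => (hrD z).trans (mul_comm _ _)) z 0]

end EntireQuotient

section WeylFunction

open Asymptotics Bornology Filter Topology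

theorem IsPencilSolution.eq_add_of_initial {T : ℝ} {p q : ℝ → ℂ} {z : ℂ}
    {y dy C dC φ dφ : ℝ → ℂ} (hy : IsPencilSolution T p q z y dy)
    (hC : IsPencilSolution T p q z C dC) (hφ : IsPencilSolution T p q z φ dφ) {s x : ℝ}
    (hs : s ∈ Icc 0 T) (hx : x ∈ Icc 0 T) (hCs : C s = 1) (hdCs : dC s = 0) (hφs : φ s = 0)
    (hdφs : dφ s = 1) :
    y x = y s * C x + dy s * φ x ∧ dy x = y s * dC x + dy s * dφ x := by
  have hCφ := hC.wronskian_eq hφ hs hx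
  have hφy := hφ.wronskian_eq hy hs hx
  have hyC := hy.wronskian_eq hC hs hx
  rw [hCs, hdCs, hφs, hdφs] at hCφ
  rw [hφs, hdφs] at hφy
  rw [hCs, hdCs] at hyC
  exact ⟨by linear_combination -y x * hCφ - C x * hφy - φ x * hyC,
    by linear_combination -dy x * hCφ - dC x * hφy - dφ x * hyC⟩

theorem abs_sub_add_abs_sub_of_mem_uIcc {e a x : ℝ} (hx : x ∈ uIcc e a) :
    |x - e| + |x - a| = |a - e| := by
  rw [← Real.dist_eq, ← Real.dist_eq, ← Real.dist_eq, dist_comm x e, dist_comm a e]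
  exact dist_add_dist_of_mem_segment (segment_eq_uIcc e a ▸ hx)

/-- `u` and `u' = ε u`, with `ε = ±1`, are values, and `du`, `du'` slopes, at one point of solutions
of two pencils, such that the Weyl functions `du / u` and `du' / u'` differ by the entire function
`F`. -/
structure HasEntireWeylDifference (u du u' du' : ℂ → ℂ) (ε : ℂ) (F : ℂ → ℂ) : Prop where
  sq_eq_one : ε ^ 2 = 1
  differentiable : Differentiable ℂ F
  apply_eq : ∀ z, u' z = ε * u z
  deriv_sub : ∀ z, ε * du' z - du z = F z * u z

namespace HasEntireWeylDifference

variable {T e a x : ℝ} {p q p' q' : ℝ → ℂ} {S dS S' dS' φ dφ φ' dφ' : ℝ → ℂ → ℂ} {ε : ℂ}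
  {F : ℂ → ℂ}

theorem mul_eq_mul (hF : HasEntireWeylDifference (S a) (dS a) (S' a) (dS' a) ε F)
    (hp : AbsolutelyContinuousOnInterval p 0 T) (hq : IntervalIntegrable q volume 0 T)
    (hp' : AbsolutelyContinuousOnInterval p' 0 T) (hq' : IntervalIntegrable q' volume 0 T)
    (he : e ∈ Icc 0 T) (ha : a ∈ Icc 0 T) (hea : e ≠ a) (hS : IsPencilFamily T p q e 0 1 S dS)
    (hS' : IsPencilFamily T p' q' e 0 1 S' dS') (hφ : IsPencilFamily T p q a 0 1 φ dφ)
    (hφ' : IsPencilFamily T p' q' a 0 1 φ' dφ') (hx : x ∈ uIcc e a) (z : ℂ) :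
    S x z * φ' x z = ε * (S' x z * φ x z) := by
  have hxT : x ∈ Icc 0 T := ordConnected_Icc.uIcc_subset he ha hx
  obtain ⟨C, dC, hC⟩ := exists_isPencilFamily ha hp.continuousOn.intervalIntegrable hq 1 0
  obtain ⟨C', dC', hC'⟩ := exists_isPencilFamily ha hp'.continuousOn.intervalIntegrable hq' 1 0
  have hid (z : ℂ) : S a z * (C x z * φ' x z - C' x z * φ x z - F z * φ x z * φ' x z) =
      S x z * φ' x z - ε * (S' x z * φ x z) := by
    rw [((hS.solution z).eq_add_of_initial (hC.solution z) (hφ.solution z) ha hxT (hC.apply_self z)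
        (hC.deriv_self z) (hφ.apply_self z) (hφ.deriv_self z)).1,
      ((hS'.solution z).eq_add_of_initial (hC'.solution z) (hφ'.solution z) ha hxT
        (hC'.apply_self z) (hC'.deriv_self z) (hφ'.apply_self z) (hφ'.deriv_self z)).1, hF.apply_eq]
    linear_combination (φ x z * φ' x z) * hF.deriv_sub z + (S a z * C' x z * φ x z) * hF.sq_eq_one
  have hO : (fun z => S x z * φ' x z - ε * (S' x z * φ x z)) =O[cobounded ℂ]
      expWeight 2 |a - e| := by
    rw [← abs_sub_add_abs_sub_of_mem_uIcc hx]
    exact (isBigO_mul_expWeight (hS.isBigO_apply hp hq he hxT)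
      (hφ'.isBigO_apply hp' hq' ha hxT)).sub ((isBigO_mul_expWeight
      (hS'.isBigO_apply hp' hq' he hxT) (hφ.isBigO_apply hp hq ha hxT)).const_mul_left ε)
  have hzero := (hS.isSineType hp hq he ha).eq_zero_of_isBigO (sub_ne_zero.2 hea.symm)
    (r := fun z => C x z * φ' x z - C' x z * φ x z - F z * φ x z * φ' x z) (by
      have := hF.differentiable
      have := hC.differentiable x hxT
      have := hC'.differentiable x hxT
      have := hφ.differentiable x hxT
      have := hφ'.differentiable x hxT
      fun_prop) (hO.congr_left fun z => (hid z).symm) z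
  exact sub_eq_zero.1 ((hid z).symm.trans (mul_eq_zero_of_right _ hzero))

theorem exists_mul_eq_sub (hF : HasEntireWeylDifference (S a) (dS a) (S' a) (dS' a) ε F)
    (hp : AbsolutelyContinuousOnInterval p 0 T) (hq : IntervalIntegrable q volume 0 T)
    (hp' : AbsolutelyContinuousOnInterval p' 0 T) (hq' : IntervalIntegrable q' volume 0 T)
    (he : e ∈ Icc 0 T) (ha : a ∈ Icc 0 T) (hea : e ≠ a) (hS : IsPencilFamily T p q e 0 1 S dS)
    (hS' : IsPencilFamily T p' q' e 0 1 S' dS') (hφ : IsPencilFamily T p q a 0 1 φ dφ)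
    (hφ' : IsPencilFamily T p' q' a 0 1 φ' dφ') (hx : x ∈ uIcc e a) :
    ∃ g : ℂ, ∀ z, S a z * g = S x z * dφ' x z - ε * (φ x z * dS' x z) := by
  have hxT : x ∈ Icc 0 T := ordConnected_Icc.uIcc_subset he ha hx
  obtain ⟨C, dC, hC⟩ := exists_isPencilFamily ha hp.continuousOn.intervalIntegrable hq 1 0
  obtain ⟨C', dC', hC'⟩ := exists_isPencilFamily ha hp'.continuousOn.intervalIntegrable hq' 1 0
  have hid (z : ℂ) : S a z * (C x z * dφ' x z - φ x z * dC' x z - F z * φ x z * dφ' x z) =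
      S x z * dφ' x z - ε * (φ x z * dS' x z) := by
    rw [((hS.solution z).eq_add_of_initial (hC.solution z) (hφ.solution z) ha hxT (hC.apply_self z)
        (hC.deriv_self z) (hφ.apply_self z) (hφ.deriv_self z)).1,
      ((hS'.solution z).eq_add_of_initial (hC'.solution z) (hφ'.solution z) ha hxT
        (hC'.apply_self z) (hC'.deriv_self z) (hφ'.apply_self z) (hφ'.deriv_self z)).2, hF.apply_eq]
    linear_combination (φ x z * dφ' x z) * hF.deriv_sub z +
      (S a z * dC' x z * φ x z) * hF.sq_eq_one
  have hO : (fun z => S x z * dφ' x z - ε * (φ x z * dS' x z)) =O[cobounded ℂ]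
      expWeight 1 |a - e| := by
    rw [← abs_sub_add_abs_sub_of_mem_uIcc hx]
    refine (isBigO_mul_expWeight (hS.isBigO_apply hp hq he hxT)
      (hφ'.isBigO_deriv hp' hq' ha hxT)).sub (IsBigO.const_mul_left ?_ ε)
    rw [add_comm |x - e|]
    exact isBigO_mul_expWeight (hφ.isBigO_apply hp hq ha hxT) (hS'.isBigO_deriv hp' hq' he hxT)
  have hconst := (hS.isSineType hp hq he ha).apply_eq_apply_of_isBigO (sub_ne_zero.2 hea.symm)
    (r := fun z => C x z * dφ' x z - φ x z * dC' x z - F z * φ x z * dφ' x z) (by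
      have := hF.differentiable
      have := hC.differentiable x hxT
      have := hC'.differentiable_deriv x hxT
      have := hφ.differentiable x hxT
      have := hφ'.differentiable_deriv x hxT
      fun_prop) (hO.congr_left fun z => (hid z).symm)
  exact ⟨_, fun z => (congrArg (S a z * ·) (hconst 0 z)).trans (hid z)⟩

theorem exists_eq_mul (hF : HasEntireWeylDifference (S a) (dS a) (S' a) (dS' a) ε F)
    (hp : AbsolutelyContinuousOnInterval p 0 T) (hq : IntervalIntegrable q volume 0 T)
    (hp' : AbsolutelyContinuousOnInterval p' 0 T) (hq' : IntervalIntegrable q' volume 0 T)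
    (he : e ∈ Icc 0 T) (ha : a ∈ Icc 0 T) (hea : e ≠ a) (hS : IsPencilFamily T p q e 0 1 S dS)
    (hS' : IsPencilFamily T p' q' e 0 1 S' dS') (hφ : IsPencilFamily T p q a 0 1 φ dφ)
    (hφ' : IsPencilFamily T p' q' a 0 1 φ' dφ') (hx : x ∈ uIcc e a) :
    ∃ g : ℂ, ∀ z, φ x z = g * φ' x z := by
  have hxT : x ∈ Icc 0 T := ordConnected_Icc.uIcc_subset he ha hx
  obtain ⟨g, hg⟩ := hF.exists_mul_eq_sub hp hq hp' hq' he ha hea hS hS' hφ hφ' hx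
  have hzero (z : ℂ) : S a z * (φ x z - g * φ' x z) = 0 := by
    have hwronskian := (hφ'.solution z).wronskian_eq (hS'.solution z) ha hxT
    rw [hφ'.apply_self, hφ'.deriv_self, hF.apply_eq] at hwronskian
    have hmul := hF.mul_eq_mul hp hq hp' hq' he ha hea hS hS' hφ hφ' hx z
    linear_combination -φ' x z * hg z - dφ' x z * hmul + ε * φ x z * hwronskian -
      (S a z * φ x z) * hF.sq_eq_one
  have hdiff : Differentiable ℂ fun z => φ x z - g * φ' x z :=
    (hφ.differentiable x hxT).sub ((hφ'.differentiable x hxT).const_mul g)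
  exact ⟨g, fun z => sub_eq_zero.1 (eq_zero_of_differentiable_of_mul_eq_zero
    (hS.differentiable a ha) hdiff
    ((hS.isSineType hp hq he ha).exists_ne_zero (sub_ne_zero.2 hea.symm)) hzero z)⟩

end HasEntireWeylDifference

end WeylFunction

section Uniqueness

namespace IsPencilFamily

variable {T a b x : ℝ} {p q p' q' : ℝ → ℂ} {φ dφ φ' dφ' : ℝ → ℂ → ℂ}

theorem sq_eq_one_and_exp_eq_of_eq_mul {g : ℂ} (hφ : IsPencilFamily T p q a 0 1 φ dφ)
    (hφ' : IsPencilFamily T p' q' a 0 1 φ' dφ') (hp : AbsolutelyContinuousOnInterval p 0 T)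
    (hq : IntervalIntegrable q volume 0 T) (hp' : AbsolutelyContinuousOnInterval p' 0 T)
    (hq' : IntervalIntegrable q' volume 0 T) (ha : a ∈ Icc 0 T) (hx : x ∈ Icc 0 T) (hxa : x ≠ a)
    (hg : ∀ z, φ' x z = g * φ x z) :
    g ^ 2 = 1 ∧ Complex.exp (Complex.I * ∫ t in a..x, (p' t - p t)) = g := by
  rw [intervalIntegral.integral_sub
    (hp'.continuousOn.mono (uIcc_subset_uIcc (Icc_subset_uIcc ha)
      (Icc_subset_uIcc hx))).intervalIntegrable
    (hp.continuousOn.mono (uIcc_subset_uIcc (Icc_subset_uIcc ha)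
      (Icc_subset_uIcc hx))).intervalIntegrable]
  exact (hφ.isSineType hp hq ha hx).sq_eq_one_and_exp_eq_of_eq_mul (hφ'.isSineType hp' hq' ha hx)
    (sub_ne_zero.2 hxa) hg

theorem eqOn_of_exists_eq_mul (hφ : IsPencilFamily T p q a 0 1 φ dφ)
    (hφ' : IsPencilFamily T p' q' a 0 1 φ' dφ') (hp : AbsolutelyContinuousOnInterval p 0 T)
    (hq : IntervalIntegrable q volume 0 T) (hp' : AbsolutelyContinuousOnInterval p' 0 T)
    (hq' : IntervalIntegrable q' volume 0 T) (ha : a ∈ Icc 0 T) (hb : b ∈ Icc 0 T) (hba : b ≠ a)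
    (hmul : ∀ x ∈ uIcc b a, ∃ g : ℂ, ∀ z, φ' x z = g * φ x z) : EqOn p p' (uIcc b a) := by
  have hJ : uIcc b a ⊆ Icc 0 T := ordConnected_Icc.uIcc_subset hb ha
  have hcont : ContinuousOn (fun x => p' x - p x) (uIcc b a) :=
    (hp'.continuousOn.sub hp.continuousOn).mono (hJ.trans Icc_subset_uIcc)
  intro x hx
  refine (sub_eq_zero.1 (eq_zero_of_exp_mul_integral_eq_one
    (mul_ne_zero two_ne_zero Complex.I_ne_zero) (min_lt_max.2 hba) hcont right_mem_uIcc
    (fun y hy => ?_) x hx)).symm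
  rcases eq_or_ne y a with rfl | hya
  · simp
  obtain ⟨g, hg⟩ := hmul y hy
  obtain ⟨hg2, hexp⟩ := hφ.sq_eq_one_and_exp_eq_of_eq_mul hφ' hp hq hp' hq' ha (hJ hy) hya hg
  rw [mul_assoc, two_mul, Complex.exp_add, hexp, ← sq, hg2]

theorem apply_eq_apply_of_exists_eq_mul (hφ : IsPencilFamily T p q a 0 1 φ dφ)
    (hφ' : IsPencilFamily T p' q' a 0 1 φ' dφ') (hp : AbsolutelyContinuousOnInterval p 0 T)
    (hq : IntervalIntegrable q volume 0 T) (hp' : AbsolutelyContinuousOnInterval p' 0 T)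
    (hq' : IntervalIntegrable q' volume 0 T) (ha : a ∈ Icc 0 T) (hx : x ∈ Icc 0 T)
    (heq : EqOn p p' (uIcc a x)) (hmul : ∃ g : ℂ, ∀ z, φ' x z = g * φ x z) (z : ℂ) :
    φ' x z = φ x z := by
  rcases eq_or_ne x a with rfl | hxa
  · rw [hφ.apply_self, hφ'.apply_self]
  obtain ⟨g, hg⟩ := hmul
  have hexp := (hφ.sq_eq_one_and_exp_eq_of_eq_mul hφ' hp hq hp' hq' ha hx hxa hg).2
  rw [intervalIntegral.integral_congr fun t ht => sub_eq_zero.2 (heq ht).symm,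
    intervalIntegral.integral_zero, mul_zero, Complex.exp_zero] at hexp
  rw [hg, ← hexp, one_mul]

theorem ae_mem_imp_eq_of_apply_eq (hφ : IsPencilFamily T p q a 0 1 φ dφ)
    (hφ' : IsPencilFamily T p' q' a 0 1 φ' dφ') (hp : AbsolutelyContinuousOnInterval p 0 T)
    (hq : IntervalIntegrable q volume 0 T) (ha : a ∈ Icc 0 T) (hb : b ∈ Icc 0 T) (hba : b ≠ a)
    (hpp : EqOn p p' (uIcc b a)) (hφφ : ∀ x ∈ uIcc b a, ∀ z, φ' x z = φ x z) :
    ∀ᵐ x, x ∈ uIcc b a → q x = q' x := by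
  have hJ : uIcc b a ⊆ Icc 0 T := ordConnected_Icc.uIcc_subset hb ha
  have hdφdφ (x) (hx : x ∈ uIcc b a) (z : ℂ) : dφ' x z = dφ x z :=
    (uniqueDiffOn_uIcc hba x hx).eq_deriv _ (((hφ'.solution z).hasDeriv x (hJ hx)).mono hJ)
      ((((hφ.solution z).hasDeriv x (hJ hx)).mono hJ).congr (fun y hy => hφφ y hy z) (hφφ x hx z))
  -- The equation holds off a null set depending on `z`; a countable dense set of `z` is enough.
  let ζ := TopologicalSpace.denseSeq ℂ
  have hddφ := ae_all_iff.2 fun n => (hφ.solution (ζ n)).ae_hasDerivAt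
  have hddφ' := ae_all_iff.2 fun n => (hφ'.solution (ζ n)).ae_hasDerivAt
  filter_upwards [hddφ, hddφ', ae_mem_uIcc_imp_uIcc_mem_nhds b a,
    compl_mem_ae_iff.2 (measure_singleton a)] with x hddφ hddφ' hnhds hxa hx
  obtain ⟨n, hn⟩ := (TopologicalSpace.denseRange_denseSeq ℂ).exists_mem_open
    (isOpen_ne_fun (hφ.differentiable x (hJ hx)).continuous continuous_const)
    ((hφ.isSineType hp hq ha (hJ hx)).exists_ne_zero (sub_ne_zero.2 hxa))
  have hev : (dφ' · (ζ n)) =ᶠ[nhds x] (dφ · (ζ n)) :=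
    Filter.mem_of_superset (hnhds hx) fun t ht => hdφdφ t ht (ζ n)
  have hmul := (hddφ n (hJ hx)).unique ((hddφ' n (hJ hx)).congr_of_eventuallyEq hev.symm)
  rw [hφφ x hx] at hmul
  have hpot := mul_right_cancel₀ hn hmul
  rw [pencilPotential, pencilPotential, hpp hx] at hpot
  linear_combination hpot

end IsPencilFamily

theorem HasEntireWeylDifference.coefficients_eq {T e a : ℝ} {p q p' q' : ℝ → ℂ}
    {S dS S' dS' : ℝ → ℂ → ℂ} {ε : ℂ} {F : ℂ → ℂ}
    (hF : HasEntireWeylDifference (S a) (dS a) (S' a) (dS' a) ε F)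
    (hp : AbsolutelyContinuousOnInterval p 0 T) (hq : IntervalIntegrable q volume 0 T)
    (hp' : AbsolutelyContinuousOnInterval p' 0 T) (hq' : IntervalIntegrable q' volume 0 T)
    (he : e ∈ Icc 0 T) (ha : a ∈ Icc 0 T) (hea : e ≠ a) (hS : IsPencilFamily T p q e 0 1 S dS)
    (hS' : IsPencilFamily T p' q' e 0 1 S' dS') :
    EqOn p p' (uIcc e a) ∧ ∀ᵐ x, x ∈ uIcc e a → q x = q' x := by
  obtain ⟨φ, dφ, hφ⟩ := exists_isPencilFamily ha hp.continuousOn.intervalIntegrable hq 0 1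
  obtain ⟨φ', dφ', hφ'⟩ := exists_isPencilFamily ha hp'.continuousOn.intervalIntegrable hq' 0 1
  have hmul (x) (hx : x ∈ uIcc e a) : ∃ g : ℂ, ∀ z, φ x z = g * φ' x z :=
    hF.exists_eq_mul hp hq hp' hq' he ha hea hS hS' hφ hφ' hx
  have hpp := hφ'.eqOn_of_exists_eq_mul hφ hp' hq' hp hq ha he hea hmul
  have hφφ (x) (hx : x ∈ uIcc e a) (z : ℂ) : φ x z = φ' x z :=
    hφ'.apply_eq_apply_of_exists_eq_mul hφ hp' hq' hp hq ha
      (ordConnected_Icc.uIcc_subset he ha hx)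
      (hpp.mono (uIcc_subset_uIcc right_mem_uIcc hx)) (hmul x hx) z
  exact ⟨hpp.symm, hφ.ae_mem_imp_eq_of_apply_eq hφ' hp hq ha he hea hpp.symm
    fun x hx z => (hφφ x hx z).symm⟩

end Uniqueness

section DirichletSpectrum

theorem pencilCauchy_eq {T x : ℝ} {p q : ℝ → ℂ} (hp : IntervalIntegrable p volume 0 T)
    (hq : IntervalIntegrable q volume 0 T) {z α β : ℂ} {y dy : ℝ → ℂ}
    (hy : IsPencilSolution T p q z y dy) (hα : y 0 = α) (hβ : dy 0 = β) (hx : x ∈ Icc 0 T) :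
    pencilCauchy T p q α β z x = y x := by
  obtain ⟨dw, hw, hwα, hwβ⟩ := Classical.epsilon_spec
    (p := fun w : ℝ → ℂ => ∃ dw, IsPencilSolution T p q z w dw ∧ w 0 = α ∧ dw 0 = β)
    ⟨y, dy, hy, hα, hβ⟩
  exact (hw.eq_of_initial hp hq hy (hwα.trans hα.symm) (hwβ.trans hβ.symm) x hx).1

theorem dirichletSpectrum_swap (T : ℝ) (p q : ℝ → ℂ) (c d : ℝ) :
    dirichletSpectrum T p q d c = dirichletSpectrum T p q c d := by
  have hneg : dirichletCharFun T p q d c = -dirichletCharFun T p q c d := by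
    ext z
    simp only [dirichletCharFun, Pi.neg_apply]
    ring
  ext1 z
  rw [dirichletSpectrum, dirichletSpectrum, hneg, analyticOrderAt_neg]

namespace IsPencilFamily

variable {T c d : ℝ} {p q p' q' : ℝ → ℂ} {S dS S' dS' : ℝ → ℂ → ℂ}

theorem dirichletCharFun_eq (hS : IsPencilFamily T p q c 0 1 S dS)
    (hp : IntervalIntegrable p volume 0 T) (hq : IntervalIntegrable q volume 0 T)
    (hc : c ∈ Icc 0 T) (hd : d ∈ Icc 0 T) : dirichletCharFun T p q c d = S d := by
  have hT : 0 ≤ T := hc.1.trans hc.2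
  have h₀ : (0 : ℝ) ∈ Icc 0 T := left_mem_Icc.2 hT
  obtain ⟨X, dX, hX⟩ := exists_isPencilFamily h₀ hp hq 1 0
  obtain ⟨Y, dY, hY⟩ := exists_isPencilFamily h₀ hp hq 0 1
  ext z
  have hX₁ (x) (hx : x ∈ Icc 0 T) : pencilX₁ T p q x z = X x z :=
    pencilCauchy_eq hp hq (hX.solution z) (hX.apply_self z) (hX.deriv_self z) hx
  have hX₂ (x) (hx : x ∈ Icc 0 T) : pencilX₂ T p q x z = Y x z :=
    pencilCauchy_eq hp hq (hY.solution z) (hY.apply_self z) (hY.deriv_self z) hx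
  rw [dirichletCharFun, hX₁ c hc, hX₁ d hd, hX₂ c hc, hX₂ d hd]
  have hXY := (hX.solution z).wronskian_eq (hY.solution z) h₀ hd
  have hYS := (hY.solution z).wronskian_eq (hS.solution z) hc hd
  have hSX := (hS.solution z).wronskian_eq (hX.solution z) hc hd
  rw [hX.apply_self, hX.deriv_self, hY.apply_self, hY.deriv_self] at hXY
  rw [hS.apply_self, hS.deriv_self] at hYS hSX
  linear_combination S d z * hXY + X d z * hYS + Y d z * hSX

theorem exists_eq_mul_of_dirichletSpectrum_le (hS : IsPencilFamily T p q c 0 1 S dS)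
    (hS' : IsPencilFamily T p' q' c 0 1 S' dS') (hp : AbsolutelyContinuousOnInterval p 0 T)
    (hq : IntervalIntegrable q volume 0 T) (hp' : AbsolutelyContinuousOnInterval p' 0 T)
    (hq' : IntervalIntegrable q' volume 0 T) (hc : c ∈ Icc 0 T) (hd : d ∈ Icc 0 T) (hdc : d ≠ c)
    (hle : dirichletSpectrum T p q c d ≤ dirichletSpectrum T p' q' c d) :
    ∃ ε : ℂ, ε ^ 2 = 1 ∧ Complex.exp (Complex.I * ∫ t in c..d, (p' t - p t)) = ε ∧
      ∀ z, S' d z = ε * S d z := by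
  obtain ⟨ε, hε⟩ := (hS.isSineType hp hq hc hd).exists_eq_mul (hS'.isSineType hp' hq' hc hd)
    (sub_ne_zero.2 hdc) (by
      rw [← hS.dirichletCharFun_eq hp.continuousOn.intervalIntegrable hq hc hd,
        ← hS'.dirichletCharFun_eq hp'.continuousOn.intervalIntegrable hq' hc hd]
      exact hle)
  have hexp := hS.sq_eq_one_and_exp_eq_of_eq_mul hS' hp hq hp' hq' hc hd hdc hε
  exact ⟨ε, hexp.1, hexp.2, hε⟩

theorem mem_dirichletEigenvalues (hS : IsPencilFamily T p q c 0 1 S dS) (hT : 0 < T)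
    (hc : c ∈ Icc 0 T) {z : ℂ} (hd : S d z = 0) : z ∈ dirichletEigenvalues T p q c d := by
  refine ⟨_, _, hS.solution z, ?_, hS.apply_self z, hd⟩
  by_contra! hzero
  refine one_ne_zero (α := ℂ) ?_
  rw [← hS.deriv_self z]
  exact (uniqueDiffOn_Icc hT c hc).eq_deriv _ ((hS.solution z).hasDeriv c hc)
    ((hasDerivWithinAt_const c (Icc 0 T) (0 : ℂ)).congr hzero (hzero c hc))

theorem exists_hasEntireWeylDifference {a s t : ℝ} {U dU U' dU' W dW W' dW' : ℝ → ℂ → ℂ}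
    (hU : IsPencilFamily T p q s 0 1 U dU) (hU' : IsPencilFamily T p' q' s 0 1 U' dU')
    (hW : IsPencilFamily T p q t 0 1 W dW) (hW' : IsPencilFamily T p' q' t 0 1 W' dW')
    (ha : a ∈ Icc 0 T) (ht : t ∈ Icc 0 T) {ε δ : ℂ} (hε : ε ^ 2 = 1) (hδ : δ ^ 2 = 1)
    (hUa : ∀ z, U' a z = ε * U a z) (hWa : ∀ z, W' a z = δ * W a z)
    (hUt : ∀ z, U' t z = ε * δ * U t z) (hU₀ : ∃ z, U a z ≠ 0)
    (hcop : ∀ z, U a z = 0 → U t z ≠ 0) :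
    ∃ F, HasEntireWeylDifference (U a) (dU a) (U' a) (dU' a) ε F ∧
      HasEntireWeylDifference (W a) (dW a) (W' a) (dW' a) δ F := by
  have hwronskian (z : ℂ) : U t z = U a z * dW a z - dU a z * W a z := by
    have h := (hU.solution z).wronskian_eq (hW.solution z) ha ht
    rw [hW.apply_self, hW.deriv_self] at h
    linear_combination h
  have hwronskian' (z : ℂ) : U' t z = U' a z * dW' a z - dU' a z * W' a z := by
    have h := (hU'.solution z).wronskian_eq (hW'.solution z) ha ht
    rw [hW'.apply_self, hW'.deriv_self] at h
    linear_combination h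
  have hmul (z : ℂ) : W a z * (ε * dU' a z - dU a z) = U a z * (δ * dW' a z - dW a z) := by
    have h := hwronskian' z
    rw [hUt, hUa, hWa, hwronskian] at h
    linear_combination ε * δ * h +
      (W a z * dU a z - U a z * dW a z - ε * W a z * dU' a z) * hδ +
      (δ ^ 2 * (W a z * dU a z - U a z * dW a z) + δ * U a z * dW' a z) * hε
  have hW₀ (z : ℂ) (hz : U a z = 0) : W a z ≠ 0 := fun h =>
    hcop z hz (by rw [hwronskian, hz, h]; ring)
  obtain ⟨F, hF, hFU, hFW⟩ := exists_differentiable_of_mul_eq_mul (hU.differentiable a ha)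
    (hW.differentiable a ha)
    (((hU'.differentiable_deriv a ha).const_mul ε).sub (hU.differentiable_deriv a ha))
    (((hW'.differentiable_deriv a ha).const_mul δ).sub (hW.differentiable_deriv a ha))
    hU₀ hW₀ hmul
  exact ⟨F, ⟨hε, hF, hUa, hFU⟩, ⟨hδ, hF, hWa, hFW⟩⟩

theorem exists_hasEntireWeylDifference_of_dirichletSpectrum_le {a s t : ℝ}
    {U dU U' dU' W dW W' dW' : ℝ → ℂ → ℂ} (hU : IsPencilFamily T p q s 0 1 U dU)
    (hU' : IsPencilFamily T p' q' s 0 1 U' dU') (hW : IsPencilFamily T p q t 0 1 W dW)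
    (hW' : IsPencilFamily T p' q' t 0 1 W' dW') (hp : AbsolutelyContinuousOnInterval p 0 T)
    (hq : IntervalIntegrable q volume 0 T) (hp' : AbsolutelyContinuousOnInterval p' 0 T)
    (hq' : IntervalIntegrable q' volume 0 T) (hs : s ∈ Icc 0 T) (ha : a ∈ Icc 0 T)
    (ht : t ∈ Icc 0 T) (has : a ≠ s) (hts : t ≠ s) (hat : a ≠ t)
    (hdisj : dirichletEigenvalues T p q s a ∩ dirichletEigenvalues T p q s t = ∅)
    (hsa : dirichletSpectrum T p q s a ≤ dirichletSpectrum T p' q' s a)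
    (hst : dirichletSpectrum T p q s t ≤ dirichletSpectrum T p' q' s t)
    (hta : dirichletSpectrum T p q t a ≤ dirichletSpectrum T p' q' t a) :
    ∃ ε δ F, HasEntireWeylDifference (U a) (dU a) (U' a) (dU' a) ε F ∧
      HasEntireWeylDifference (W a) (dW a) (W' a) (dW' a) δ F := by
  obtain ⟨ε, hε, hεexp, hUa⟩ :=
    hU.exists_eq_mul_of_dirichletSpectrum_le hU' hp hq hp' hq' hs ha has hsa
  obtain ⟨c, -, hcexp, hUt⟩ :=
    hU.exists_eq_mul_of_dirichletSpectrum_le hU' hp hq hp' hq' hs ht hts hst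
  obtain ⟨δ, hδ, hδexp, hWa⟩ :=
    hW.exists_eq_mul_of_dirichletSpectrum_le hW' hp hq hp' hq' ht ha hat hta
  have hint : IntervalIntegrable (fun x => p' x - p x) volume 0 T :=
    hp'.continuousOn.intervalIntegrable.sub hp.continuousOn.intervalIntegrable
  have hc : c = ε * δ := by
    have hmul : c * δ = ε := by
      rw [← hcexp, ← hδexp, ← Complex.exp_add, ← mul_add,
        intervalIntegral.integral_add_adjacent_intervals
          (hint.mono_set (uIcc_subset_uIcc (Icc_subset_uIcc hs) (Icc_subset_uIcc ht)))
          (hint.mono_set (uIcc_subset_uIcc (Icc_subset_uIcc ht) (Icc_subset_uIcc ha))), hεexp]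
    linear_combination δ * hmul - c * hδ
  have hT : 0 < T := (hs.1.trans hs.2).lt_of_ne fun h =>
    hts (subsingleton_Icc_of_ge h.ge ht hs)
  exact ⟨ε, δ, hU.exists_hasEntireWeylDifference hU' hW hW' ha ht hε hδ hUa hWa
    (fun z => hc ▸ hUt z) ((hU.isSineType hp hq hs ha).exists_ne_zero (sub_ne_zero.2 has))
    fun z hz hzt => hdisj.subset
      ⟨hU.mem_dirichletEigenvalues hT hs hz, hU.mem_dirichletEigenvalues hT hs hzt⟩⟩

end IsPencilFamily

end DirichletSpectrum

theorem theorem4_general (T a : ℝ) (ha : a ∈ Ioo 0 T) (p q pt qt : ℝ → ℂ)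
    (hp : AbsolutelyContinuousOnInterval p 0 T) (hq : IntervalIntegrable q volume 0 T)
    (hp' : AbsolutelyContinuousOnInterval pt 0 T) (hq' : IntervalIntegrable qt volume 0 T)
    (hS : dirichletEigenvalues T p q 0 a ∩ dirichletEigenvalues T p q 0 T = ∅)
    (h₀ : dirichletSpectrum T p q 0 a ≤ dirichletSpectrum T pt qt 0 a)
    (h₁ : dirichletSpectrum T p q 0 T ≤ dirichletSpectrum T pt qt 0 T)
    (h₂ : dirichletSpectrum T p q a T ≤ dirichletSpectrum T pt qt a T) :
    (∀ x ∈ Icc 0 T, p x = pt x) ∧ q =ᵐ[volume.restrict (Ioo 0 T)] qt := by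
  have hT : 0 < T := ha.1.trans ha.2
  have hpi : IntervalIntegrable p volume 0 T := hp.continuousOn.intervalIntegrable
  have hpi' : IntervalIntegrable pt volume 0 T := hp'.continuousOn.intervalIntegrable
  have h0T : (0 : ℝ) ∈ Icc 0 T := left_mem_Icc.2 hT.le
  have hTT : T ∈ Icc 0 T := right_mem_Icc.2 hT.le
  have haT : a ∈ Icc 0 T := Ioo_subset_Icc_self ha
  obtain ⟨U, dU, hU⟩ := exists_isPencilFamily h0T hpi hq 0 1
  obtain ⟨U', dU', hU'⟩ := exists_isPencilFamily h0T hpi' hq' 0 1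
  obtain ⟨W, dW, hW⟩ := exists_isPencilFamily hTT hpi hq 0 1
  obtain ⟨W', dW', hW'⟩ := exists_isPencilFamily hTT hpi' hq' 0 1
  rw [← dirichletSpectrum_swap, ← dirichletSpectrum_swap T pt] at h₂
  obtain ⟨ε, δ, F, hFU, hFW⟩ := hU.exists_hasEntireWeylDifference_of_dirichletSpectrum_le hU' hW hW'
    hp hq hp' hq' h0T haT hTT ha.1.ne' hT.ne' ha.2.ne hS h₀ h₁ h₂
  obtain ⟨hpU, hqU⟩ := hFU.coefficients_eq hp hq hp' hq' h0T haT ha.1.ne hU hU'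
  obtain ⟨hpW, hqW⟩ := hFW.coefficients_eq hp hq hp' hq' hTT haT ha.2.ne' hW hW'
  have hcover : Icc 0 T ⊆ uIcc 0 a ∪ uIcc T a := by
    rw [uIcc_comm T a, uIcc_of_le ha.1.le, uIcc_of_le ha.2.le,
      Icc_union_Icc_eq_Icc ha.1.le ha.2.le]
  refine ⟨fun x hx => (hcover hx).elim (@hpU x) (@hpW x), ?_⟩
  rw [Filter.EventuallyEq, ae_restrict_iff' measurableSet_Ioo]
  filter_upwards [hqU, hqW] with x hxU hxW hx
  exact (hcover (Ioo_subset_Icc_self hx)).elim hxU hxW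

theorem theorem4 (T a : ℝ) (ha : a ∈ Ioo 0 T)
    (p q pt qt : ℝ → ℂ)
    (hp : AbsolutelyContinuousOnInterval p 0 T) (hq : IntervalIntegrable q volume 0 T)
    (hp' : AbsolutelyContinuousOnInterval pt 0 T) (hq' : IntervalIntegrable qt volume 0 T)
    (hint : ∫ x in (0 : ℝ)..T, p x = ∫ x in (0 : ℝ)..T, pt x)
    (hS : dirichletEigenvalues T p q 0 a ∩ dirichletEigenvalues T p q 0 T = ∅)
    (h₀ : dirichletSpectrum T p q 0 a = dirichletSpectrum T pt qt 0 a)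
    (h₁ : dirichletSpectrum T p q 0 T = dirichletSpectrum T pt qt 0 T)
    (h₂ : dirichletSpectrum T p q a T = dirichletSpectrum T pt qt a T) :
    (∀ x ∈ Icc 0 T, p x = pt x) ∧ q =ᵐ[volume.restrict (Ioo 0 T)] qt :=
  theorem4_general T a ha p q pt qt hp hq hp' hq' hS h₀.le h₁.le h₂.le
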